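/- Let $\mathcal H_A,\mathcal H_B$ be finite-dimensional complex Hilbert spaces, $d_B=\dim\mathcal H_B$, and let $\mathscr B=\{\mathcal B_x\}_{x=1}^m$ ($m\ge 1$), $\mathcal B_x=\{|\psi_{xk}\rangle\}_k$, be any set of orthonormal bases of $\mathcal H_A$. Its transition graph has one vertex for each pair $(x,k)$, and two different vertices $(x,k)$ and $(y,l)$ are adjacent iff $\langle\psi_{xk}|\psi_{yl}\rangle\neq 0$; let $G_1,\dots,G_g$ be its connected components. For each $a$, the component subspace $\mathcal H_{A,a}$ is the span of the $|\psi_{xk}\rangle$ with $(x,k)\in G_a$, the component projector is $P_a=\sum_{k:(x,k)\in G_a}|\psi_{xk}\rangle\langle\psi_{xk}|$, and the component rank is $r_a=\operatorname{tr}P_a$ (for a fixed basis index $x$; none of these depends on the choice of $x$). A state $\rho$ (density operator, pure or mixed) on $\mathcal H_A\otimes\mathcal H_B$ is a zero-uncertainty state with respect to $\mathscr B$ if for each $x$ there is a POVM $\{\Pi_{xk}\}_k$ on $\mathcal H_B$ with $\sum_k\operatorname{tr}[\rho(|\psi_{xk}\rangle\langle\psi_{xk}|\otimes\Pi_{xk})]=1$.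 A state on $\mathcal H\otimes\mathcal H_B$ is maximally entangled if every state on $\mathcal H\otimes\mathcal H_B$ can be created from it by local operations and classical communication (LOCC); a subnormalized maximally entangled state is a multiple $q\,\sigma$, $0<q\le 1$, of a maximally entangled state $\sigma$. Theorem. Let $\rho$ be a state on $\mathcal H_A\otimes\mathcal H_B$ and $\rho_a=(P_a\otimes 1)\rho(P_a\otimes 1)$. Then $\rho$ is a zero-uncertainty state with respect to $\mathscr B$ if and only if the following three conditions hold: 1. $r_a\le d_B$ whenever $\operatorname{tr}\rho_a>0$; 2. each $\rho_a$ with $\operatorname{tr}\rho_a>0$ is a subnormalized maximally entangled state on $\mathcal H_{A,a}\otimes\mathcal H_B$; 3. the operators $\operatorname{tr}_A\rho_a$, $a=1,\dots,g$, have mutually orthogonal supports. -/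

import Mathlib

open scoped TensorProduct

noncomputable section

namespace ZeroUncertainty

universe u v

/-! ## States on finite-dimensional Hilbert spaces -/

section Basic

variable {E F : Type*} [NormedAddCommGroup E] [InnerProductSpace ℂ E] [FiniteDimensional ℂ E]
  [NormedAddCommGroup F] [InnerProductSpace ℂ F] [FiniteDimensional ℂ F]

/-- A quantum state (density operator): a positive semidefinite operator of unit trace. -/
def IsState (T : E →ₗ[ℂ] E) : Prop :=
  T.IsPositive ∧ LinearMap.trace ℂ E T = 1

/-- The rank-one operator `|ψ⟩⟨ψ|`. -/
def ketBra (ψ : E) : E →ₗ[ℂ] E :=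
  (InnerProductSpace.rankOne ℂ ψ ψ).toLinearMap

/-- The support of an operator: the orthogonal complement of its kernel. -/
def support (T : E →ₗ[ℂ] E) : Submodule ℂ E :=
  (LinearMap.ker T)ᗮ

/-- Conjugation `T ↦ K T K†` by an operator `K : E → F`. -/
def conjBy (K : E →ₗ[ℂ] F) : (E →ₗ[ℂ] E) →ₗ[ℂ] (F →ₗ[ℂ] F) where
  toFun T := K ∘ₗ T ∘ₗ LinearMap.adjoint K
  map_add' S T := by rw [LinearMap.add_comp, LinearMap.comp_add]
  map_smul' c T := by rw [LinearMap.smul_comp, LinearMap.comp_smul, RingHom.id_apply]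

/-- The operators `K i` are the Kraus operators of a complete local measurement:
`∑ i, (K i)† (K i) = 1`. -/
def IsKraus {n : ℕ} (K : Fin n → (E →ₗ[ℂ] F)) : Prop :=
  ∑ i, LinearMap.adjoint (K i) ∘ₗ K i = LinearMap.id

end Basic

/-! ## Bipartite operators -/

section Bipartite

variable {A B : Type*} [NormedAddCommGroup A] [InnerProductSpace ℂ A] [FiniteDimensional ℂ A]
  [NormedAddCommGroup B] [InnerProductSpace ℂ B] [FiniteDimensional ℂ B]

/-- The conditional operator `⟨ψ|T|ψ⟩` of Bob, for a vector `ψ` of Alice: the operator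
`(⟨ψ| ⊗ 1) T (|ψ⟩ ⊗ 1)` on `B`. -/
def condOp (ψ : A) (T : A ⊗[ℂ] B →ₗ[ℂ] A ⊗[ℂ] B) : B →ₗ[ℂ] B :=
  LinearMap.adjoint (TensorProduct.mk ℂ A B ψ) ∘ₗ T ∘ₗ TensorProduct.mk ℂ A B ψ

/-- The partial trace `tr_A T = ∑ i, ⟨e i|T|e i⟩` over an orthonormal basis of `A`. -/
def partialTraceA (T : A ⊗[ℂ] B →ₗ[ℂ] A ⊗[ℂ] B) : B →ₗ[ℂ] B :=
  ∑ i, condOp (stdOrthonormalBasis ℂ A i) T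

/-- An operator on `A ⊗ B` compressed to `K ⊗ B`, for a subspace `K` of `A`. For an operator that
is supported on `K ⊗ B`, this is the same operator regarded as an operator on `K ⊗ B`. -/
def restrictA (K : Submodule ℂ A) (T : A ⊗[ℂ] B →ₗ[ℂ] A ⊗[ℂ] B) :
    (K ⊗[ℂ] B) →ₗ[ℂ] (K ⊗[ℂ] B) :=
  conjBy ((LinearMap.adjoint K.subtype).rTensor B) T

end Bipartite

/-! ## LOCC and maximally entangled states -/

/-- `IsLOCC Λ`: the linear map `Λ`, from operators on `A ⊗ B` to operators on `A' ⊗ B'`, is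
realized by a protocol of local operations and classical communication with finitely many rounds.
Either nothing more is done; or one of the parties performs a local measurement with finitely many
outcomes, described by Kraus operators into an arbitrary finite-dimensional local space (so local
ancillas, local channels and discarding local systems are covered), the outcome is announced,
and the parties continue with an LOCC protocol that may depend on the outcome. -/
inductive IsLOCC {A' : Type u} {B' : Type v}
    [NormedAddCommGroup A'] [InnerProductSpace ℂ A'] [FiniteDimensional ℂ A']
    [NormedAddCommGroup B'] [InnerProductSpace ℂ B'] [FiniteDimensional ℂ B'] :
    ∀ {A : Type u} {B : Type v}
    [NormedAddCommGroup A] [InnerProductSpace ℂ A] [FiniteDimensional ℂ A]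
    [NormedAddCommGroup B] [InnerProductSpace ℂ B] [FiniteDimensional ℂ B],
    ((A ⊗[ℂ] B →ₗ[ℂ] A ⊗[ℂ] B) →ₗ[ℂ] (A' ⊗[ℂ] B' →ₗ[ℂ] A' ⊗[ℂ] B')) → Prop
  | nil : IsLOCC (LinearMap.id : (A' ⊗[ℂ] B' →ₗ[ℂ] A' ⊗[ℂ] B') →ₗ[ℂ] _)
  | alice {A C : Type u} {B : Type v}
      [NormedAddCommGroup A] [InnerProductSpace ℂ A] [FiniteDimensional ℂ A]
      [NormedAddCommGroup C] [InnerProductSpace ℂ C] [FiniteDimensional ℂ C]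
      [NormedAddCommGroup B] [InnerProductSpace ℂ B] [FiniteDimensional ℂ B]
      {n : ℕ} (K : Fin n → (A →ₗ[ℂ] C)) (hK : IsKraus K)
      (Λ : Fin n → ((C ⊗[ℂ] B →ₗ[ℂ] C ⊗[ℂ] B) →ₗ[ℂ] (A' ⊗[ℂ] B' →ₗ[ℂ] A' ⊗[ℂ] B')))
      (hΛ : ∀ i, IsLOCC (Λ i)) :
      IsLOCC (∑ i, Λ i ∘ₗ conjBy ((K i).rTensor B))
  | bob {A : Type u} {B C : Type v}
      [NormedAddCommGroup A] [InnerProductSpace ℂ A] [FiniteDimensional ℂ A]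
      [NormedAddCommGroup B] [InnerProductSpace ℂ B] [FiniteDimensional ℂ B]
      [NormedAddCommGroup C] [InnerProductSpace ℂ C] [FiniteDimensional ℂ C]
      {n : ℕ} (K : Fin n → (B →ₗ[ℂ] C)) (hK : IsKraus K)
      (Λ : Fin n → ((A ⊗[ℂ] C →ₗ[ℂ] A ⊗[ℂ] C) →ₗ[ℂ] (A' ⊗[ℂ] B' →ₗ[ℂ] A' ⊗[ℂ] B')))
      (hΛ : ∀ i, IsLOCC (Λ i)) :
      IsLOCC (∑ i, Λ i ∘ₗ conjBy ((K i).lTensor A))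

section MES

variable {A : Type u} {B : Type v}
  [NormedAddCommGroup A] [InnerProductSpace ℂ A] [FiniteDimensional ℂ A]
  [NormedAddCommGroup B] [InnerProductSpace ℂ B] [FiniteDimensional ℂ B]

/-- A maximally entangled state (MES) on `A ⊗ B`: a state from which every state on `A ⊗ B` can be
created by LOCC. -/
def IsMES (ρ : A ⊗[ℂ] B →ₗ[ℂ] A ⊗[ℂ] B) : Prop :=
  IsState ρ ∧ ∀ σ : A ⊗[ℂ] B →ₗ[ℂ] A ⊗[ℂ] B, IsState σ →
    ∃ Λ : (A ⊗[ℂ] B →ₗ[ℂ] A ⊗[ℂ] B) →ₗ[ℂ] (A ⊗[ℂ] B →ₗ[ℂ] A ⊗[ℂ] B), IsLOCC Λ ∧ Λ ρ = σ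

/-- A subnormalized MES: a positive multiple `q ρ`, with `q ≤ 1`, of an MES `ρ`. -/
def IsSubnormalizedMES (T : A ⊗[ℂ] B →ₗ[ℂ] A ⊗[ℂ] B) : Prop :=
  ∃ (q : ℝ) (ρ : A ⊗[ℂ] B →ₗ[ℂ] A ⊗[ℂ] B), 0 < q ∧ q ≤ 1 ∧ IsMES ρ ∧ T = (q : ℂ) • ρ

end MES

/-! ## Basis sets, transition graphs and zero-uncertainty states -/

section BasisSet

variable {HA : Type u} {HB : Type v}
  [NormedAddCommGroup HA] [InnerProductSpace ℂ HA] [FiniteDimensional ℂ HA]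
  [NormedAddCommGroup HB] [InnerProductSpace ℂ HB] [FiniteDimensional ℂ HB]
  {m d : ℕ}

/-- A POVM on `HB` with outcomes `Fin d`. -/
def IsPOVM (M : Fin d → (HB →ₗ[ℂ] HB)) : Prop :=
  (∀ k, (M k).IsPositive) ∧ ∑ k, M k = LinearMap.id

/-- The probability `∑ k, tr[ρ (|ψ k⟩⟨ψ k| ⊗ M k)]` that Bob, measuring the POVM `M`, guesses
the outcome of Alice's measurement on the basis `ψ`. -/
def guessProb (ψ : OrthonormalBasis (Fin d) ℂ HA) (M : Fin d → (HB →ₗ[ℂ] HB))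
    (ρ : HA ⊗[ℂ] HB →ₗ[ℂ] HA ⊗[ℂ] HB) : ℂ :=
  ∑ k, LinearMap.trace ℂ (HA ⊗[ℂ] HB) (ρ ∘ₗ TensorProduct.map (ketBra (ψ k)) (M k))

/-- `ρ` is a zero-uncertainty state (ZUS) with respect to the basis set `ℬ`: for each basis, Bob
has a measurement that predicts the outcome of Alice with certainty. -/
def IsZUS (ℬ : Fin m → OrthonormalBasis (Fin d) ℂ HA)
    (ρ : HA ⊗[ℂ] HB →ₗ[ℂ] HA ⊗[ℂ] HB) : Prop :=
  ∀ x, ∃ M : Fin d → (HB →ₗ[ℂ] HB), IsPOVM M ∧ guessProb (ℬ x) M ρ = 1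

/-- The transition graph of a basis set: its vertices are the pairs `(x, k)`, standing for the
`k`-th state of the `x`-th basis; two different vertices are adjacent iff the corresponding
states are not orthogonal. -/
def transitionGraph (ℬ : Fin m → OrthonormalBasis (Fin d) ℂ HA) :
    SimpleGraph (Fin m × Fin d) where
  Adj p q := p ≠ q ∧ inner ℂ (ℬ p.1 p.2) (ℬ q.1 q.2) ≠ 0
  symm := ⟨fun _ _ h => ⟨h.1.symm, fun h0 => h.2 (inner_eq_zero_symm.mp h0)⟩⟩
  loopless := ⟨fun _ h => h.1 rfl⟩

/-- The irreducible components of a basis set, labelled by the connected components of its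
transition graph. -/
abbrev Component (ℬ : Fin m → OrthonormalBasis (Fin d) ℂ HA) : Type :=
  (transitionGraph ℬ).ConnectedComponent

/-- The component subspace: the span of those states of the basis `ℬ x` that belong to the
component `a` (it does not depend on the choice of `x`). -/
def componentSubspace (ℬ : Fin m → OrthonormalBasis (Fin d) ℂ HA) (x : Fin m)
    (a : Component ℬ) : Submodule ℂ HA :=
  Submodule.span ℂ {ψ | ∃ k, (x, k) ∈ a.supp ∧ ℬ x k = ψ}

open Classical in
/-- The component projector `P_a`: the sum of `|ψ⟩⟨ψ|` over those states `ψ` of the basis `ℬ x`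
that belong to the component `a` (it does not depend on the choice of `x`). -/
def componentProj (ℬ : Fin m → OrthonormalBasis (Fin d) ℂ HA) (x : Fin m)
    (a : Component ℬ) : HA →ₗ[ℂ] HA :=
  ∑ k with (x, k) ∈ a.supp, ketBra (ℬ x k)

/-- The component rank `r_a = tr P_a` (a natural number, written as a real number). -/
def componentRank (ℬ : Fin m → OrthonormalBasis (Fin d) ℂ HA) (x : Fin m)
    (a : Component ℬ) : ℝ :=
  (LinearMap.trace ℂ HA (componentProj ℬ x a)).re

/-- `ρ_a = (P_a ⊗ 1) ρ (P_a ⊗ 1)`. -/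
def componentState (ℬ : Fin m → OrthonormalBasis (Fin d) ℂ HA) (x : Fin m)
    (ρ : HA ⊗[ℂ] HB →ₗ[ℂ] HA ⊗[ℂ] HB) (a : Component ℬ) : HA ⊗[ℂ] HB →ₗ[ℂ] HA ⊗[ℂ] HB :=
  (componentProj ℬ x a).rTensor HB ∘ₗ ρ ∘ₗ (componentProj ℬ x a).rTensor HB

end BasisSet

end ZeroUncertainty

end

open ZeroUncertainty

noncomputable section

set_option linter.unusedSectionVars false

/-! Factor `ρ = R R†` and study the slices `R_ψ = (⟨ψ| ⊗ 1) R`. Bob guesses a basis outcome with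
certainty iff the slices along different vectors of that basis have orthogonal ranges
(`isZUS_iff_inner_bra`), so everything reduces to the Gram operators `R_ψ† R_φ`.

From zero uncertainty to the conditions: expand `R_ψ† R_φ` in two bases at once, with `ψ` in one and
`φ` in the other. Each expansion collapses to one term, and if `ψ` and `φ` overlap the two Gram
operators coincide (`inner_bra_eq_of_adj`). They are therefore constant along each component, where
`R_ψ† R_φ = ⟨φ, ψ⟩ G` (`exists_inner_bra_componentFactor`). Diagonalizing `G` writes the component
state as a mixture of maximally entangled vectors that Bob can tell apart. He identifies the vector
and steers it to any target, Alice correcting by a unitary (`exists_isLOCC`). The rank bound holds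
because slices along an orthonormal basis embed that basis orthogonally into `B`; slices from
different components are orthogonal.

Conversely, let a component state be maximally entangled with rank at most `dim B`. Then LOCC
converts it to a maximally entangled vector `Φ`. LOCC maps are separable, and a separable map takes
`v` to `Φ` with total weight at most `(∑ ‖slice‖)² / r ≤ ‖v‖²` (`sum_norm_inner_sq_le`). Perfect
conversion forces equality, so all slices of each `R e` along an orthonormal basis have equal norm.
Polarization in `ψ`, then in `e`, makes slices along orthogonal vectors orthogonal. Between
components, orthogonality is the support condition. -/

namespace ZeroUncertainty

/-! ### Slices of bipartite vectors, and factorizations `T = R R†`. -/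

section Bra

variable {A B E F : Type*} [NormedAddCommGroup A] [InnerProductSpace ℂ A] [FiniteDimensional ℂ A]
  [NormedAddCommGroup B] [InnerProductSpace ℂ B] [FiniteDimensional ℂ B]
  [NormedAddCommGroup E] [InnerProductSpace ℂ E] [FiniteDimensional ℂ E]
  [NormedAddCommGroup F] [InnerProductSpace ℂ F] [FiniteDimensional ℂ F]

/-- The partial contraction `⟨ψ| ⊗ 1 : A ⊗ B → B`. -/
def bra (ψ : A) : A ⊗[ℂ] B →ₗ[ℂ] B :=
  LinearMap.adjoint (TensorProduct.mk ℂ A B ψ)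

lemma inner_bra (ψ : A) (b : B) (v : A ⊗[ℂ] B) : inner ℂ b (bra ψ v) = inner ℂ (ψ ⊗ₜ[ℂ] b) v := by
  simp [bra, LinearMap.adjoint_inner_right]

lemma adjoint_bra (ψ : A) :
    LinearMap.adjoint (bra ψ : A ⊗[ℂ] B →ₗ[ℂ] B) = TensorProduct.mk ℂ A B ψ := by
  simp [bra]

@[simp] lemma bra_tmul (ψ a : A) (b : B) : bra ψ (a ⊗ₜ[ℂ] b) = inner ℂ ψ a • b := by
  refine ext_inner_left ℂ fun c => ?_
  rw [inner_bra, TensorProduct.inner_tmul, inner_smul_right]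

lemma bra_add (ψ φ : A) : (bra (ψ + φ) : A ⊗[ℂ] B →ₗ[ℂ] B) = bra ψ + bra φ := by
  simp [bra]

lemma bra_smul (c : ℂ) (ψ : A) :
    (bra (c • ψ) : A ⊗[ℂ] B →ₗ[ℂ] B) = starRingEnd ℂ c • bra ψ := by
  simp [bra, map_smulₛₗ]

@[simp] lemma bra_zero : (bra 0 : A ⊗[ℂ] B →ₗ[ℂ] B) = 0 := by
  simp [bra]

lemma bra_sum {ι : Type*} (s : Finset ι) (f : ι → A) :
    (bra (∑ i ∈ s, f i) : A ⊗[ℂ] B →ₗ[ℂ] B) = ∑ i ∈ s, bra (f i) := by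
  simp [bra]

lemma bra_comp_map {A' B' : Type*} [NormedAddCommGroup A'] [InnerProductSpace ℂ A']
    [FiniteDimensional ℂ A'] [NormedAddCommGroup B'] [InnerProductSpace ℂ B']
    [FiniteDimensional ℂ B'] (ψ : A') (f : A →ₗ[ℂ] A') (g : B →ₗ[ℂ] B') :
    bra ψ ∘ₗ TensorProduct.map f g = g ∘ₗ bra (LinearMap.adjoint f ψ) := by
  ext a b
  simp [LinearMap.adjoint_inner_left]

lemma bra_rTensor {A' : Type*} [NormedAddCommGroup A'] [InnerProductSpace ℂ A']
    [FiniteDimensional ℂ A'] (ψ : A') (f : A →ₗ[ℂ] A') (v : A ⊗[ℂ] B) :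
    bra ψ (f.rTensor B v) = bra (LinearMap.adjoint f ψ) v :=
  LinearMap.congr_fun (bra_comp_map ψ f LinearMap.id) v

lemma sum_tmul_bra {ι : Type*} [Fintype ι] (h : OrthonormalBasis ι ℂ A) (v : A ⊗[ℂ] B) :
    ∑ i, h i ⊗ₜ[ℂ] bra (h i) v = v := by
  induction v using TensorProduct.induction_on with
  | zero => simp
  | tmul a b =>
    simp_rw [bra_tmul, ← TensorProduct.smul_tmul, ← TensorProduct.sum_tmul]
    rw [h.sum_repr' a]
  | add v w hv hw => simp_rw [map_add, TensorProduct.tmul_add, Finset.sum_add_distrib, hv, hw]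

lemma inner_eq_sum_bra {ι : Type*} [Fintype ι] (h : OrthonormalBasis ι ℂ A) (v w : A ⊗[ℂ] B) :
    inner ℂ v w = ∑ i, inner ℂ (bra (h i) v) (bra (h i) w) := by
  conv_lhs => rw [← sum_tmul_bra h v]
  simp_rw [sum_inner, inner_bra]

lemma norm_sq_eq_sum_bra {ι : Type*} [Fintype ι] (h : OrthonormalBasis ι ℂ A) (v : A ⊗[ℂ] B) :
    ‖v‖ ^ 2 = ∑ i, ‖bra (h i) v‖ ^ 2 := by
  have := inner_eq_sum_bra h v v
  simp_rw [inner_self_eq_norm_sq_to_K] at this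
  apply Complex.ofReal_injective
  push_cast
  exact (inner_self_eq_norm_sq_to_K (𝕜 := ℂ) v).symm.trans this

@[simp] lemma ketBra_apply (ψ φ : E) : ketBra ψ φ = inner ℂ ψ φ • ψ := rfl

lemma isPositive_ketBra (ψ : E) : (ketBra ψ).IsPositive := by
  refine (LinearMap.isPositive_iff _).2 ⟨fun x y => ?_, fun x => ?_⟩
  · simp [inner_smul_left, inner_smul_right, mul_comm]
  · rw [ketBra_apply, inner_smul_left, ← inner_conj_symm ψ x, Complex.conj_conj,
      ← Complex.normSq_eq_conj_mul_self.trans (mul_comm _ _)]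
    exact_mod_cast Complex.normSq_nonneg _

@[simp] lemma adjoint_ketBra (ψ : E) : LinearMap.adjoint (ketBra ψ) = ketBra ψ :=
  (isPositive_ketBra ψ).adjoint_eq

lemma conjBy_ketBra (K : E →ₗ[ℂ] F) (ψ : E) : conjBy K (ketBra ψ) = ketBra (K ψ) := by
  ext x
  simp [conjBy, LinearMap.adjoint_inner_right]

@[simp] lemma ketBra_zero : ketBra (0 : E) = 0 := by ext; simp

lemma ketBra_smul (c : ℂ) (ψ : E) :
    ketBra (c • ψ) = ((‖c‖ ^ 2 : ℝ) : ℂ) • ketBra ψ := by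
  ext x
  simp only [ketBra_apply, inner_smul_left, smul_smul, LinearMap.smul_apply]
  congr 1
  have : (starRingEnd ℂ) c * c = ((‖c‖ ^ 2 : ℝ) : ℂ) := by
    rw [← Complex.normSq_eq_conj_mul_self, Complex.normSq_eq_norm_sq]
  rw [← this]; ring

lemma sum_ketBra {ι : Type*} [Fintype ι] (h : OrthonormalBasis ι ℂ E) :
    ∑ i, ketBra (h i) = LinearMap.id := by
  ext x
  simp [LinearMap.sum_apply, h.sum_repr' x]

lemma comp_adjoint_eq_sum_ketBra {ι : Type*} [Fintype ι] (e : OrthonormalBasis ι ℂ E)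
    (R : E →ₗ[ℂ] F) : R ∘ₗ LinearMap.adjoint R = ∑ i, ketBra (R (e i)) := by
  ext x
  conv_lhs => rw [LinearMap.comp_apply, ← e.sum_repr' (LinearMap.adjoint R x)]
  simp [LinearMap.sum_apply, LinearMap.adjoint_inner_right]

/-- Scale an eigenbasis by the square roots of the eigenvalues. Statements about a state thereby
become statements about the vectors `R e`. -/
lemma exists_comp_adjoint {T : E →ₗ[ℂ] E} (hT : T.IsPositive) :
    ∃ R : E →ₗ[ℂ] E, T = R ∘ₗ LinearMap.adjoint R := by
  have hs := hT.isSymmetric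
  set b := hs.eigenvectorBasis rfl with hb
  set c : Fin (Module.finrank ℂ E) → ℂ := fun i => (Real.sqrt (hs.eigenvalues rfl i) : ℝ) with hc
  refine ⟨b.toBasis.constr ℂ fun i => c i • b i, ?_⟩
  rw [comp_adjoint_eq_sum_ketBra b]
  have h1 : ∀ i, b.toBasis.constr ℂ (fun i => c i • b i) (b i) = c i • b i := fun i => by
    rw [← b.coe_toBasis, Module.Basis.constr_basis]
  refine b.toBasis.ext fun i => ?_
  simp only [h1, ketBra_smul, LinearMap.sum_apply, LinearMap.smul_apply, ketBra_apply,
    OrthonormalBasis.coe_toBasis, b.inner_eq_ite, ite_smul, one_smul, zero_smul, smul_ite,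
    smul_zero, Finset.sum_ite_eq', Finset.mem_univ, if_true]
  rw [hb, hs.apply_eigenvectorBasis, hc]
  simp [abs_of_nonneg (Real.sqrt_nonneg _), Real.sq_sqrt (hT.nonneg_eigenvalues rfl i)]

lemma trace_comp_adjoint {ι : Type*} [Fintype ι] (e : OrthonormalBasis ι ℂ E) (R : E →ₗ[ℂ] F) :
    LinearMap.trace ℂ F (R ∘ₗ LinearMap.adjoint R) = ((∑ i, ‖R (e i)‖ ^ 2 : ℝ) : ℂ) := by
  rw [LinearMap.trace_comp_comm', LinearMap.trace_eq_sum_inner _ e]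
  simp [LinearMap.adjoint_inner_right, inner_self_eq_norm_sq_to_K]

lemma eq_zero_of_trace_comp_adjoint {R : E →ₗ[ℂ] F}
    (h : (LinearMap.trace ℂ F (R ∘ₗ LinearMap.adjoint R)).re = 0) : R = 0 := by
  have e := stdOrthonormalBasis ℂ E
  rw [trace_comp_adjoint e, Complex.ofReal_re,
    Finset.sum_eq_zero_iff_of_nonneg (fun i _ => by positivity)] at h
  exact e.toBasis.ext fun i => by simpa using h i (Finset.mem_univ i)

lemma re_trace_comp_adjoint_nonneg (R : E →ₗ[ℂ] F) :
    0 ≤ (LinearMap.trace ℂ F (R ∘ₗ LinearMap.adjoint R)).re := by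
  rw [trace_comp_adjoint (stdOrthonormalBasis ℂ E), Complex.ofReal_re]
  positivity

lemma conjBy_comp_adjoint {G : Type*} [NormedAddCommGroup G] [InnerProductSpace ℂ G]
    [FiniteDimensional ℂ G] (K : F →ₗ[ℂ] G) (R : E →ₗ[ℂ] F) :
    conjBy K (R ∘ₗ LinearMap.adjoint R) = (K ∘ₗ R) ∘ₗ LinearMap.adjoint (K ∘ₗ R) := by
  simp [conjBy, LinearMap.adjoint_comp, LinearMap.comp_assoc]

lemma condOp_comp_adjoint (ψ : A) (R : E →ₗ[ℂ] A ⊗[ℂ] B) :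
    condOp ψ (R ∘ₗ LinearMap.adjoint R) =
      (bra ψ ∘ₗ R) ∘ₗ LinearMap.adjoint (bra ψ ∘ₗ R) := by
  rw [LinearMap.adjoint_comp, adjoint_bra, condOp, bra, LinearMap.comp_assoc, LinearMap.comp_assoc]

lemma map_ketBra (ψ : A) (M : B →ₗ[ℂ] B) :
    TensorProduct.map (ketBra ψ) M = TensorProduct.mk ℂ A B ψ ∘ₗ M ∘ₗ bra ψ := by
  ext a b
  simp [TensorProduct.smul_tmul]

lemma trace_comp_map_ketBra (ψ : A) (M : B →ₗ[ℂ] B) (T : A ⊗[ℂ] B →ₗ[ℂ] A ⊗[ℂ] B) :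
    LinearMap.trace ℂ _ (T ∘ₗ TensorProduct.map (ketBra ψ) M) =
      LinearMap.trace ℂ B (condOp ψ T ∘ₗ M) := by
  rw [map_ketBra, condOp, ← bra, ← LinearMap.comp_assoc, ← LinearMap.comp_assoc,
    LinearMap.trace_comp_comm']
  simp only [LinearMap.comp_assoc]

lemma trace_eq_sum_condOp {ι : Type*} [Fintype ι] (h : OrthonormalBasis ι ℂ A)
    (T : A ⊗[ℂ] B →ₗ[ℂ] A ⊗[ℂ] B) :
    LinearMap.trace ℂ _ T = ∑ i, LinearMap.trace ℂ B (condOp (h i) T) := by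
  have : T = ∑ i, T ∘ₗ TensorProduct.map (ketBra (h i)) LinearMap.id := by
    have : ∑ i, TensorProduct.map (ketBra (h i)) (LinearMap.id : B →ₗ[ℂ] B) = LinearMap.id := by
      simp_rw [← LinearMap.rTensor_def]
      rw [← LinearMap.coe_rTensorHom, ← map_sum, sum_ketBra]
      simp
    refine LinearMap.ext fun v => ?_
    rw [LinearMap.sum_apply]
    simp only [LinearMap.comp_apply]
    rw [← map_sum, ← LinearMap.sum_apply, this, LinearMap.id_apply]
  conv_lhs => rw [this]
  simp [trace_comp_map_ketBra]

/-- Each matrix element of the partial trace is itself the trace of an operator on `A`, hence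
independent of the basis. -/
lemma partialTraceA_eq {ι : Type*} [Fintype ι] (h : OrthonormalBasis ι ℂ A)
    (T : A ⊗[ℂ] B →ₗ[ℂ] A ⊗[ℂ] B) : partialTraceA T = ∑ i, condOp (h i) T := by
  refine LinearMap.ext fun w => ext_inner_left ℂ fun z => ?_
  trans LinearMap.trace ℂ A (LinearMap.adjoint ((TensorProduct.mk ℂ A B).flip z) ∘ₗ T ∘ₗ
    (TensorProduct.mk ℂ A B).flip w)
  · rw [LinearMap.trace_eq_sum_inner _ (stdOrthonormalBasis ℂ A)]
    simp [partialTraceA, LinearMap.sum_apply, inner_sum, condOp, LinearMap.adjoint_inner_right]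
  · rw [LinearMap.trace_eq_sum_inner _ h]
    simp [LinearMap.sum_apply, inner_sum, condOp, LinearMap.adjoint_inner_right]

end Bra

/-! ### LOCC maps have product Kraus operators. -/

section Separable

variable {E F G : Type*} [NormedAddCommGroup E] [InnerProductSpace ℂ E] [FiniteDimensional ℂ E]
  [NormedAddCommGroup F] [InnerProductSpace ℂ F] [FiniteDimensional ℂ F]
  [NormedAddCommGroup G] [InnerProductSpace ℂ G] [FiniteDimensional ℂ G]

lemma conjBy_conjBy (L : F →ₗ[ℂ] G) (K : E →ₗ[ℂ] F) (T : E →ₗ[ℂ] E) :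
    conjBy L (conjBy K T) = conjBy (L ∘ₗ K) T := by
  simp [conjBy, LinearMap.adjoint_comp, LinearMap.comp_assoc]

lemma inner_conjBy_comp_adjoint {ι : Type*} [Fintype ι] (e : OrthonormalBasis ι ℂ E)
    (R : E →ₗ[ℂ] F) (K : F →ₗ[ℂ] G) (v : G) :
    inner ℂ v (conjBy K (R ∘ₗ LinearMap.adjoint R) v) =
      ((∑ k, ‖(inner ℂ v (K (R (e k))) : ℂ)‖ ^ 2 : ℝ) : ℂ) := by
  rw [conjBy_comp_adjoint, comp_adjoint_eq_sum_ketBra e, LinearMap.sum_apply, inner_sum]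
  push_cast
  refine Finset.sum_congr rfl fun k _ => ?_
  rw [ketBra_apply, inner_smul_right, ← inner_conj_symm, ← Complex.normSq_eq_conj_mul_self,
    Complex.normSq_eq_norm_sq]
  push_cast
  rfl

lemma sum_norm_sq_of_sum_adjoint_comp {ι : Type*} [Fintype ι] (K : ι → E →ₗ[ℂ] F)
    (hK : ∑ i, LinearMap.adjoint (K i) ∘ₗ K i = LinearMap.id) (v : E) :
    ∑ i, ‖K i v‖ ^ 2 = ‖v‖ ^ 2 := by
  have h : inner ℂ v ((∑ i, LinearMap.adjoint (K i) ∘ₗ K i) v) = inner ℂ v v := by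
    rw [hK]; rfl
  simp_rw [LinearMap.sum_apply, inner_sum, LinearMap.comp_apply, LinearMap.adjoint_inner_right] at h
  simp_rw [inner_self_eq_norm_sq_to_K] at h
  exact_mod_cast h

lemma sum_sum_adjoint_comp {ι : Type*} [Fintype ι] {κ : ι → Type*} [∀ i, Fintype (κ i)]
    {K : ι → E →ₗ[ℂ] F} (hK : ∑ i, LinearMap.adjoint (K i) ∘ₗ K i = LinearMap.id)
    {M : ∀ i, κ i → F →ₗ[ℂ] G}
    (hM : ∀ i, ∑ j, LinearMap.adjoint (M i j) ∘ₗ M i j = LinearMap.id) :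
    ∑ i, ∑ j, LinearMap.adjoint (M i j ∘ₗ K i) ∘ₗ (M i j ∘ₗ K i) = LinearMap.id := by
  rw [← hK]
  refine Finset.sum_congr rfl fun i _ => LinearMap.ext fun v => ?_
  have := LinearMap.congr_fun (hM i) (K i v)
  rw [LinearMap.sum_apply] at this ⊢
  simp only [LinearMap.adjoint_comp, LinearMap.comp_apply, LinearMap.id_apply] at this ⊢
  rw [← map_sum, this]

lemma IsKraus.rTensor {n : ℕ} {K : Fin n → E →ₗ[ℂ] F} (hK : IsKraus K) :
    ∑ i, LinearMap.adjoint ((K i).rTensor G) ∘ₗ (K i).rTensor G = LinearMap.id := by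
  simp_rw [LinearMap.adjoint_rTensor, ← LinearMap.rTensor_comp]
  rw [IsKraus] at hK
  rw [← LinearMap.rTensor_id, ← hK, ← LinearMap.coe_rTensorHom, map_sum]

lemma IsKraus.lTensor {n : ℕ} {K : Fin n → E →ₗ[ℂ] F} (hK : IsKraus K) :
    ∑ i, LinearMap.adjoint ((K i).lTensor G) ∘ₗ (K i).lTensor G = LinearMap.id := by
  simp_rw [LinearMap.adjoint_lTensor, ← LinearMap.lTensor_comp]
  rw [IsKraus] at hK
  rw [← LinearMap.lTensor_id, ← hK, ← LinearMap.coe_lTensorHom, map_sum]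

lemma inner_smul_ketBra {ψ : E} (hψ : ‖ψ‖ = 1) (q : ℂ) :
    inner ℂ ψ ((q • ketBra ψ) ψ) = q := by
  rw [LinearMap.smul_apply, ketBra_apply, inner_smul_right, inner_smul_right,
    inner_self_eq_norm_sq_to_K, hψ]
  simp

/-- Every LOCC map is separable. -/
lemma IsLOCC.exists_separable {A' : Type*} {B' : Type*}
    [NormedAddCommGroup A'] [InnerProductSpace ℂ A'] [FiniteDimensional ℂ A']
    [NormedAddCommGroup B'] [InnerProductSpace ℂ B'] [FiniteDimensional ℂ B']
    {A : Type _} {B : Type _}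
    [NormedAddCommGroup A] [InnerProductSpace ℂ A] [FiniteDimensional ℂ A]
    [NormedAddCommGroup B] [InnerProductSpace ℂ B] [FiniteDimensional ℂ B]
    {Λ : (A ⊗[ℂ] B →ₗ[ℂ] A ⊗[ℂ] B) →ₗ[ℂ] (A' ⊗[ℂ] B' →ₗ[ℂ] A' ⊗[ℂ] B')} (hΛ : IsLOCC Λ) :
    ∃ (ι : Type) (_ : Fintype ι) (a : ι → A →ₗ[ℂ] A') (b : ι → B →ₗ[ℂ] B'),
      (∀ T, Λ T = ∑ i, conjBy (TensorProduct.map (a i) (b i)) T) ∧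
      ∑ i, LinearMap.adjoint (TensorProduct.map (a i) (b i)) ∘ₗ TensorProduct.map (a i) (b i) =
        LinearMap.id := by
  induction hΛ with
  | nil =>
    refine ⟨Unit, inferInstance, fun _ => LinearMap.id, fun _ => LinearMap.id, fun T => ?_, ?_⟩
    · simp [conjBy]
    · simp
  | alice K hK Λ hΛ ih =>
    choose ι hι a b h1 h2 using ih
    refine ⟨Σ i, ι i, inferInstance, fun p => a p.1 p.2 ∘ₗ K p.1, fun p => b p.1 p.2,
      fun T => ?_, ?_⟩
    · simp only [LinearMap.sum_apply, LinearMap.comp_apply, h1, Fintype.sum_sigma, conjBy_conjBy]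
      refine Finset.sum_congr rfl fun i _ => Finset.sum_congr rfl fun j _ => ?_
      rw [LinearMap.map_comp_rTensor]
    · simp only [Fintype.sum_sigma, ← LinearMap.map_comp_rTensor]
      exact sum_sum_adjoint_comp hK.rTensor h2
  | bob K hK Λ hΛ ih =>
    choose ι hι a b h1 h2 using ih
    refine ⟨Σ i, ι i, inferInstance, fun p => a p.1 p.2, fun p => b p.1 p.2 ∘ₗ K p.1,
      fun T => ?_, ?_⟩
    · simp only [LinearMap.sum_apply, LinearMap.comp_apply, h1, Fintype.sum_sigma, conjBy_conjBy]
      refine Finset.sum_congr rfl fun i _ => Finset.sum_congr rfl fun j _ => ?_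
      rw [LinearMap.map_comp_lTensor]
    · simp only [Fintype.sum_sigma, ← LinearMap.map_comp_lTensor]
      exact sum_sum_adjoint_comp hK.lTensor h2

end Separable

/-! ### Fidelity of separable conversion to a maximally entangled vector. -/

section Bound

variable {A B A' B' E : Type*} [NormedAddCommGroup A] [InnerProductSpace ℂ A]
  [FiniteDimensional ℂ A] [NormedAddCommGroup B] [InnerProductSpace ℂ B] [FiniteDimensional ℂ B]
  [NormedAddCommGroup A'] [InnerProductSpace ℂ A'] [FiniteDimensional ℂ A']
  [NormedAddCommGroup B'] [InnerProductSpace ℂ B'] [FiniteDimensional ℂ B']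
  [NormedAddCommGroup E] [InnerProductSpace ℂ E] [FiniteDimensional ℂ E]

lemma norm_inner_map_le {ι : Type*} [Fintype ι] (h : OrthonormalBasis ι ℂ A) {c : ℝ}
    (Φ : A' ⊗[ℂ] B') (hΦ : ∀ ψ, ‖bra ψ Φ‖ ≤ c * ‖ψ‖) (f : A →ₗ[ℂ] A') (g : B →ₗ[ℂ] B')
    (v : A ⊗[ℂ] B) :
    ‖(inner ℂ Φ (TensorProduct.map f g v) : ℂ)‖ ≤
      c * ∑ j, ‖f (h j)‖ * ‖g (bra (h j) v)‖ := by
  conv_lhs => rw [← sum_tmul_bra h v]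
  rw [map_sum, inner_sum, Finset.mul_sum]
  refine (norm_sum_le _ _).trans (Finset.sum_le_sum fun j _ => ?_)
  rw [TensorProduct.map_tmul, norm_inner_symm, ← inner_bra, ← mul_assoc, norm_inner_symm]
  exact (norm_inner_le_norm _ _).trans (mul_le_mul_of_nonneg_right (hΦ _) (norm_nonneg _))

/-- A separable map converts a vector `v` to `Φ` with a fidelity bounded by the square of
the sum of the norms of the slices of `v`. -/
lemma sum_norm_inner_sq_le {ι κ : Type*} [Fintype ι] [Fintype κ] (h : OrthonormalBasis ι ℂ A)
    {c : ℝ} (Φ : A' ⊗[ℂ] B') (hΦ : ∀ ψ, ‖bra ψ Φ‖ ≤ c * ‖ψ‖)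
    (f : κ → A →ₗ[ℂ] A') (g : κ → B →ₗ[ℂ] B')
    (hfg : ∑ i, LinearMap.adjoint (TensorProduct.map (f i) (g i)) ∘ₗ
      TensorProduct.map (f i) (g i) = LinearMap.id) (v : A ⊗[ℂ] B) :
    ∑ i, ‖(inner ℂ Φ (TensorProduct.map (f i) (g i) v) : ℂ)‖ ^ 2 ≤
      c ^ 2 * (∑ j, ‖bra (h j) v‖) ^ 2 := by
  set s : ι → ℝ := fun j => ‖bra (h j) v‖ with hs
  have hs0 : ∀ j, 0 ≤ s j := fun j => norm_nonneg _
  -- Completeness of the Kraus operators, tested on the product vector of `h j` and the `k`-th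
  -- slice.
  have hprod : ∀ j k, ∑ i, ‖f i (h j)‖ ^ 2 * ‖g i (bra (h k) v)‖ ^ 2 = s k ^ 2 := by
    intro j k
    have := sum_norm_sq_of_sum_adjoint_comp _ hfg (h j ⊗ₜ[ℂ] bra (h k) v)
    simpa [mul_pow] using this
  -- Cauchy–Schwarz with weights `s j` and `1 / s j`, chosen so that summing over `i` with `hprod`
  -- leaves `s j * s k`. If `s k = 0` the slice vanishes, so division by zero is harmless.
  have hterm : ∀ i, ‖(inner ℂ Φ (TensorProduct.map (f i) (g i) v) : ℂ)‖ ^ 2 ≤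
      c ^ 2 * ((∑ j, s j * ‖f i (h j)‖ ^ 2) * ∑ k, ‖g i (bra (h k) v)‖ ^ 2 / s k) := by
    intro i
    refine (pow_le_pow_left₀ (norm_nonneg _) (norm_inner_map_le h Φ hΦ (f i) (g i) v) 2).trans ?_
    rw [mul_pow]
    refine mul_le_mul_of_nonneg_left ?_ (sq_nonneg c)
    refine Finset.sum_sq_le_sum_mul_sum_of_sq_le_mul _ (fun j _ => by positivity)
      (fun j _ => by positivity) fun j _ => ?_
    by_cases h0 : s j = 0
    · have : bra (h j) v = 0 := norm_eq_zero.1 h0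
      simp [this, h0]
    · apply le_of_eq
      field_simp
  calc _ ≤ ∑ i, c ^ 2 * ((∑ j, s j * ‖f i (h j)‖ ^ 2) * ∑ k, ‖g i (bra (h k) v)‖ ^ 2 / s k) :=
        Finset.sum_le_sum fun i _ => hterm i
    _ = c ^ 2 * ∑ j, ∑ k, s j * ((∑ i, ‖f i (h j)‖ ^ 2 * ‖g i (bra (h k) v)‖ ^ 2) / s k) := by
        rw [← Finset.mul_sum]
        congr 1
        simp_rw [Finset.sum_mul_sum, Finset.sum_div, Finset.mul_sum]
        rw [Finset.sum_comm]
        refine Finset.sum_congr rfl fun j _ => ?_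
        rw [Finset.sum_comm]
        refine Finset.sum_congr rfl fun k _ => Finset.sum_congr rfl fun i _ => ?_
        ring
    _ = c ^ 2 * (∑ j, s j) ^ 2 := by
        simp_rw [hprod]
        rw [sq (∑ j, s j), Finset.sum_mul_sum]
        congr 1
        refine Finset.sum_congr rfl fun j _ => Finset.sum_congr rfl fun k _ => ?_
        by_cases h0 : s k = 0
        · simp [h0]
        · field_simp

lemma exists_orthonormalBasis_apply_eq {ψ : E} (hψ : ‖ψ‖ = 1) :
    ∃ (b : OrthonormalBasis (Fin (Module.finrank ℂ E)) ℂ E) (i : _), b i = ψ := by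
  have hn : Nontrivial E := ⟨ψ, 0, by rintro rfl; simp at hψ⟩
  have hpos : 0 < Module.finrank ℂ E := Module.finrank_pos
  obtain ⟨b, hb⟩ := Orthonormal.exists_orthonormalBasis_extension_of_card_eq (𝕜 := ℂ)
    (ι := Fin (Module.finrank ℂ E)) (E := E) (by simp) (v := fun _ => ψ) (s := {⟨0, hpos⟩})
    ⟨fun _ => hψ, fun i j hij => (hij (Subsingleton.elim _ _)).elim⟩
  exact ⟨b, ⟨0, hpos⟩, hb _ rfl⟩

lemma exists_maximallyEntangled (hA : 0 < Module.finrank ℂ A)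
    (hAB : Module.finrank ℂ A ≤ Module.finrank ℂ B) :
    ∃ Φ : A ⊗[ℂ] B, ‖Φ‖ = 1 ∧ ∀ ψ, ‖bra ψ Φ‖ ^ 2 = ‖ψ‖ ^ 2 / Module.finrank ℂ A := by
  set h := stdOrthonormalBasis ℂ A
  set b := stdOrthonormalBasis ℂ B
  set r := Module.finrank ℂ A with hr
  have hr0 : (0 : ℝ) < r := by exact_mod_cast hA
  set c : ℂ := (((Real.sqrt r)⁻¹ : ℝ) : ℂ) with hc
  have hcn : ‖c‖ ^ 2 = 1 / r := by
    rw [hc, Complex.norm_real, Real.norm_eq_abs, sq_abs, inv_pow, Real.sq_sqrt hr0.le, one_div]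
  have key : ∀ ψ, ‖bra ψ (c • ∑ i, h i ⊗ₜ[ℂ] b (Fin.castLE hAB i))‖ ^ 2 =
      ‖ψ‖ ^ 2 / r := by
    intro ψ
    rw [map_smul, norm_smul, mul_pow, hcn, map_sum]
    simp_rw [bra_tmul]
    have hb : Orthonormal ℂ fun i : Fin r => b (Fin.castLE hAB i) :=
      b.orthonormal.comp _ (Fin.castLE_injective hAB)
    have := hb.inner_sum (fun i => inner ℂ ψ (h i)) (fun i => inner ℂ ψ (h i)) Finset.univ
    have h2 : ‖∑ i, (inner ℂ ψ (h i) : ℂ) • b (Fin.castLE hAB i)‖ ^ 2 = ‖ψ‖ ^ 2 := by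
      rw [← h.sum_sq_norm_inner_left ψ]
      apply Complex.ofReal_injective
      have e := (inner_self_eq_norm_sq_to_K (𝕜 := ℂ)
        (∑ i, (inner ℂ ψ (h i) : ℂ) • b (Fin.castLE hAB i))).symm.trans this
      push_cast
      refine e.trans (Finset.sum_congr rfl fun i _ => ?_)
      rw [← Complex.normSq_eq_conj_mul_self, Complex.normSq_eq_norm_sq]
      push_cast
      rfl
    rw [h2]; ring
  refine ⟨c • ∑ i, h i ⊗ₜ[ℂ] b (Fin.castLE hAB i), ?_, key⟩
  have := norm_sq_eq_sum_bra h (c • ∑ i, h i ⊗ₜ[ℂ] b (Fin.castLE hAB i))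
  simp_rw [key, h.norm_eq_one] at this
  rw [← sq_eq_sq₀ (norm_nonneg _) zero_le_one, this]
  simp [hr0.ne']

lemma isState_ketBra {ψ : E} (hψ : ‖ψ‖ = 1) : IsState (ketBra ψ) := by
  refine ⟨isPositive_ketBra ψ, ?_⟩
  rw [ketBra, InnerProductSpace.trace_rankOne, inner_self_eq_norm_sq_to_K, hψ]
  simp

/-- The equality case of Cauchy–Schwarz against the constant vector: the defect is half of `∑ i, ∑
j, (s i - s j) ^ 2`. -/
lemma eq_of_sum_sq_le {ι : Type*} [Fintype ι] (s : ι → ℝ)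
    (h : (Fintype.card ι : ℝ) * ∑ j, s j ^ 2 ≤ (∑ j, s j) ^ 2) (i j : ι) : s i = s j := by
  have h1 : ∑ i, ∑ j, (s i - s j) ^ 2 ≤ 0 := by
    have : ∑ i, ∑ j, (s i - s j) ^ 2 =
        2 * ((Fintype.card ι : ℝ) * ∑ j, s j ^ 2) - 2 * (∑ j, s j) ^ 2 := by
      simp_rw [sub_sq, Finset.sum_add_distrib, Finset.sum_sub_distrib, mul_assoc,
        ← Finset.mul_sum, ← Finset.sum_mul]
      simp [← Finset.mul_sum]
      ring
    linarith
  have h2 : ∑ i, ∑ j, (s i - s j) ^ 2 = 0 := le_antisymm h1 (by positivity)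
  rw [Finset.sum_eq_zero_iff_of_nonneg fun i _ => by positivity] at h2
  have h3 := h2 i (Finset.mem_univ i)
  rw [Finset.sum_eq_zero_iff_of_nonneg fun i _ => by positivity] at h3
  exact sub_eq_zero.1 (pow_eq_zero_iff two_ne_zero |>.1 (h3 j (Finset.mem_univ j)))

end Bound

/-! ### Rigidity of maximally entangled states: slices of equal norm. -/

section MES

universe u v

variable {A : Type u} {B : Type v} {E : Type*} [NormedAddCommGroup A] [InnerProductSpace ℂ A]
  [FiniteDimensional ℂ A] [NormedAddCommGroup B] [InnerProductSpace ℂ B] [FiniteDimensional ℂ B]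
  [NormedAddCommGroup E] [InnerProductSpace ℂ E] [FiniteDimensional ℂ E]

/-- Conversion to `Φ` saturates the fidelity bound for every vector of an eigenensemble-free
decomposition `R (eb k)`. Extending `e` and `ψ` to orthonormal bases makes the saturated bound speak
about them. -/
lemma norm_bra_sq_of_isSubnormalizedMES_of_norm_eq_one {R : E →ₗ[ℂ] A ⊗[ℂ] B}
    (hR : IsSubnormalizedMES (R ∘ₗ LinearMap.adjoint R))
    (hAB : Module.finrank ℂ A ≤ Module.finrank ℂ B) {e : E} (he : ‖e‖ = 1) {ψ : A}
    (hψ : ‖ψ‖ = 1) : ‖bra ψ (R e)‖ ^ 2 = ‖R e‖ ^ 2 / Module.finrank ℂ A := by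
  obtain ⟨h, j0, hj0⟩ := exists_orthonormalBasis_apply_eq hψ
  obtain ⟨eb, k0, hk0⟩ := exists_orthonormalBasis_apply_eq he
  have hA : 0 < Module.finrank ℂ A := j0.pos
  have hr : (0 : ℝ) < Module.finrank ℂ A := by exact_mod_cast hA
  obtain ⟨Φ, hΦ1, hΦ⟩ := exists_maximallyEntangled hA hAB
  obtain ⟨q, ρ, hq, -, hρ, hT⟩ := hR
  obtain ⟨Λ, hΛ, hΛΦ⟩ := hρ.2 _ (isState_ketBra hΦ1)
  obtain ⟨κ, _, f, g, hfg, hid⟩ := hΛ.exists_separable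
  have hqtr : q = ∑ k, ‖R (eb k)‖ ^ 2 := by
    apply Complex.ofReal_injective
    rw [← trace_comp_adjoint eb R, hT, map_smul, hρ.1.2, smul_eq_mul, mul_one]
  -- The output is exactly `q |Φ⟩⟨Φ|`, so its expectation in `Φ` recovers the whole trace `q`.
  -- Together with `hqtr` this makes the termwise bounds below equalities.
  have hqin : q = ∑ k, ∑ i, ‖(inner ℂ Φ (TensorProduct.map (f i) (g i) (R (eb k))) : ℂ)‖ ^ 2 := by
    apply Complex.ofReal_injective
    have h1 : inner ℂ Φ (Λ (R ∘ₗ LinearMap.adjoint R) Φ) = (q : ℂ) := by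
      rw [hT, map_smul, hΛΦ]
      exact inner_smul_ketBra hΦ1 _
    rw [← h1, hfg, LinearMap.sum_apply, inner_sum, Finset.sum_comm]
    simp_rw [inner_conjBy_comp_adjoint eb]
    push_cast
    rfl
  set c : ℝ := Real.sqrt (1 / Module.finrank ℂ A) with hc
  have hc2 : c ^ 2 = 1 / Module.finrank ℂ A := Real.sq_sqrt (by positivity)
  have hΦc : ∀ ψ, ‖bra ψ Φ‖ ≤ c * ‖ψ‖ := fun ψ => by
    refine le_of_sq_le_sq ?_ (by positivity)
    rw [mul_pow, hc2, hΦ]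
    apply le_of_eq; ring
  have hb1 : ∀ k, ∑ i, ‖(inner ℂ Φ (TensorProduct.map (f i) (g i) (R (eb k))) : ℂ)‖ ^ 2 ≤
      1 / Module.finrank ℂ A * (∑ j, ‖bra (h j) (R (eb k))‖) ^ 2 := fun k => by
    rw [← hc2]
    exact sum_norm_inner_sq_le h Φ hΦc f g hid _
  have hb2 : ∀ k, 1 / Module.finrank ℂ A * (∑ j, ‖bra (h j) (R (eb k))‖) ^ 2 ≤ ‖R (eb k)‖ ^ 2 := by
    intro k
    rw [norm_sq_eq_sum_bra h (R (eb k)), one_div, inv_mul_le_iff₀ hr]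
    have := sq_sum_le_card_mul_sum_sq (s := Finset.univ) (f := fun j => ‖bra (h j) (R (eb k))‖)
    simpa using this
  have heq : ∀ k, ∑ i, ‖(inner ℂ Φ (TensorProduct.map (f i) (g i) (R (eb k))) : ℂ)‖ ^ 2 =
      ‖R (eb k)‖ ^ 2 := fun k =>
    (Finset.sum_eq_sum_iff_of_le fun k _ => (hb1 k).trans (hb2 k)).1 (hqin.symm.trans hqtr) k
      (Finset.mem_univ k)
  have hcon : ∀ i j, ‖bra (h i) (R e)‖ = ‖bra (h j) (R e)‖ := by
    refine eq_of_sum_sq_le (fun j => ‖bra (h j) (R e)‖) ?_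
    have := (heq k0).symm.le.trans (hb1 k0)
    rw [hk0, one_div, le_inv_mul_iff₀ hr, norm_sq_eq_sum_bra h] at this
    simpa using this
  have := norm_sq_eq_sum_bra h (R e)
  simp_rw [fun j => hcon j j0, hj0] at this
  rw [this]
  have := hr.ne'
  simp only [Finset.sum_const, Finset.card_univ, Fintype.card_fin, nsmul_eq_mul]
  field_simp

lemma norm_bra_sq_of_isSubnormalizedMES {R : E →ₗ[ℂ] A ⊗[ℂ] B}
    (hR : IsSubnormalizedMES (R ∘ₗ LinearMap.adjoint R))
    (hAB : Module.finrank ℂ A ≤ Module.finrank ℂ B) (e : E) (ψ : A) :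
    ‖bra ψ (R e)‖ ^ 2 = ‖ψ‖ ^ 2 * (‖R e‖ ^ 2 / Module.finrank ℂ A) := by
  by_cases hψ : ψ = 0
  · simp [hψ]
  by_cases he : e = 0
  · simp [he]
  have hψn : ‖ψ‖ ≠ 0 := norm_ne_zero_iff.2 hψ
  have hen : ‖e‖ ≠ 0 := norm_ne_zero_iff.2 he
  have := norm_bra_sq_of_isSubnormalizedMES_of_norm_eq_one hR hAB (e := (‖e‖⁻¹ : ℂ) • e)
    (by simp [norm_smul, hen]) (ψ := (‖ψ‖⁻¹ : ℂ) • ψ) (by simp [norm_smul, hψn])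
  simp only [bra_smul, LinearMap.smul_apply, map_smul, norm_smul, map_inv₀, Complex.conj_ofReal,
    norm_inv, Complex.norm_real, norm_norm, mul_pow] at this
  field_simp at this
  rw [this]
  ring

/-- For fixed `e` the map `ψ ↦ R_ψ e` scales all norms by one factor, so polarization shows that it
preserves orthogonality. The vector `Complex.I • φ` supplies the imaginary part. -/
lemma inner_bra_eq_zero_of_isSubnormalizedMES {R : E →ₗ[ℂ] A ⊗[ℂ] B}
    (hR : IsSubnormalizedMES (R ∘ₗ LinearMap.adjoint R))
    (hAB : Module.finrank ℂ A ≤ Module.finrank ℂ B) (e : E) {ψ φ : A} (h : inner ℂ ψ φ = (0 : ℂ)) :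
    inner ℂ (bra ψ (R e)) (bra φ (R e)) = (0 : ℂ) := by
  have key : ∀ φ : A, inner ℂ ψ φ = (0 : ℂ) →
      RCLike.re (inner ℂ (bra ψ (R e)) (bra φ (R e)) : ℂ) = 0 := by
    intro φ h
    have h1 := norm_bra_sq_of_isSubnormalizedMES hR hAB e (ψ + φ)
    rw [bra_add, LinearMap.add_apply, norm_add_sq (𝕜 := ℂ), norm_add_sq (𝕜 := ℂ), h,
      norm_bra_sq_of_isSubnormalizedMES hR hAB e ψ,
      norm_bra_sq_of_isSubnormalizedMES hR hAB e φ] at h1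
    simp only [map_zero, mul_zero, add_zero] at h1
    linarith
  have h1 := key φ h
  have h2 := key (Complex.I • φ) (by rw [inner_smul_right, h, mul_zero])
  rw [bra_smul, LinearMap.smul_apply, inner_smul_right] at h2
  refine Complex.ext ?_ ?_
  · simpa using h1
  · simpa using h2

end MES

/-! ### Schmidt decomposition and sums of rank-one operators. -/

section Schmidt

variable {A B E F : Type*} [NormedAddCommGroup A] [InnerProductSpace ℂ A]
  [FiniteDimensional ℂ A] [NormedAddCommGroup B] [InnerProductSpace ℂ B] [FiniteDimensional ℂ B]
  [NormedAddCommGroup E] [InnerProductSpace ℂ E] [FiniteDimensional ℂ E]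
  [NormedAddCommGroup F] [InnerProductSpace ℂ F] [FiniteDimensional ℂ F]

/-- A Schmidt decomposition: the slices of `τ` along a suitable basis of `A` are orthogonal. -/
lemma exists_schmidt (τ : A ⊗[ℂ] B) :
    ∃ h : OrthonormalBasis (Fin (Module.finrank ℂ A)) ℂ A,
      ∀ i j, i ≠ j → inner ℂ (bra (h i) τ) (bra (h j) τ) = (0 : ℂ) := by
  set b := stdOrthonormalBasis ℂ B
  set w : _ → A := fun k => LinearMap.adjoint ((TensorProduct.mk ℂ A B).flip (b k)) τ with hw
  -- `N` is Alice's reduced operator; by `key` it is the Gram form of the slices, so its eigenbasis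
  -- makes them orthogonal.
  set N : A →ₗ[ℂ] A := ∑ k, ketBra (w k) with hN
  have hpos : N.IsPositive := LinearMap.isPositive_sum _ fun k _ => isPositive_ketBra _
  have hbw : ∀ ψ k, inner ℂ (b k) (bra ψ τ) = inner ℂ ψ (w k) := fun ψ k => by
    rw [inner_bra, hw, LinearMap.adjoint_inner_right]
    rfl
  have key : ∀ ψ φ, inner ℂ (bra φ τ) (bra ψ τ) = inner ℂ ψ (N φ) := by
    intro ψ φ
    rw [← b.sum_inner_mul_inner, hN, LinearMap.sum_apply, inner_sum]
    refine Finset.sum_congr rfl fun k _ => ?_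
    rw [hbw, ketBra_apply, inner_smul_right, ← inner_conj_symm, hbw, inner_conj_symm]
  refine ⟨hpos.isSymmetric.eigenvectorBasis rfl, fun i j hij => ?_⟩
  rw [key, hpos.isSymmetric.apply_eigenvectorBasis, inner_smul_right,
    OrthonormalBasis.inner_eq_zero _ hij.symm, mul_zero]

/-- The operator `∑ i, |f i⟩⟨w i|`. -/
def sumRankOne {ι : Type*} [Fintype ι] (f : ι → F) (w : ι → E) : E →ₗ[ℂ] F :=
  ∑ i, (InnerProductSpace.rankOne ℂ (f i) (w i)).toLinearMap

lemma sumRankOne_apply {ι : Type*} [Fintype ι] (f : ι → F) (w : ι → E) (x : E) :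
    sumRankOne f w x = ∑ i, (inner ℂ (w i) x : ℂ) • f i := by
  simp [sumRankOne, LinearMap.sum_apply]

lemma adjoint_sumRankOne {ι : Type*} [Fintype ι] (f : ι → F) (w : ι → E) :
    LinearMap.adjoint (sumRankOne f w) = sumRankOne w f := by
  refine ((LinearMap.eq_adjoint_iff _ _).2 fun x y => ?_).symm
  rw [sumRankOne_apply, sumRankOne_apply, sum_inner, inner_sum]
  refine Finset.sum_congr rfl fun i _ => ?_
  rw [inner_smul_left, inner_smul_right, inner_conj_symm, mul_comm]

lemma adjoint_sumRankOne_comp {ι : Type*} [Fintype ι] {f : ι → F}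
    (hf : ∀ i j, i ≠ j → inner ℂ (f i) (f j) = (0 : ℂ)) (w : ι → E) :
    LinearMap.adjoint (sumRankOne f w) ∘ₗ sumRankOne f w =
      ∑ i, ((‖f i‖ ^ 2 : ℝ) : ℂ) • ketBra (w i) := by
  ext x
  rw [adjoint_sumRankOne, LinearMap.comp_apply, sumRankOne_apply, LinearMap.sum_apply]
  refine Finset.sum_congr rfl fun i _ => ?_
  rw [sumRankOne_apply, inner_sum, Finset.sum_eq_single i]
  · rw [inner_smul_right, inner_self_eq_norm_sq_to_K, LinearMap.smul_apply, ketBra_apply, smul_smul,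
      mul_comm]
    push_cast
    rfl
  · intro j _ hj
    rw [inner_smul_right, hf i j hj.symm, mul_zero]
  · simp

end Schmidt

/-! ### The steering protocol: Bob measures, Alice corrects. -/

section Protocol

universe u v

variable {A A' : Type u} {B B' : Type v} [NormedAddCommGroup A] [InnerProductSpace ℂ A]
  [FiniteDimensional ℂ A] [NormedAddCommGroup B] [InnerProductSpace ℂ B] [FiniteDimensional ℂ B]
  [NormedAddCommGroup A'] [InnerProductSpace ℂ A']
  [FiniteDimensional ℂ A'] [NormedAddCommGroup B'] [InnerProductSpace ℂ B']
  [FiniteDimensional ℂ B']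

/-- Bob measures, and Alice applies an isometry that depends on his outcome. -/
lemma isLOCC_bob_alice {κ : Type*} [Fintype κ] (K : κ → B →ₗ[ℂ] B')
    (hK : ∑ k, LinearMap.adjoint (K k) ∘ₗ K k = LinearMap.id) (U : κ → A →ₗ[ℂ] A')
    (hU : ∀ k, LinearMap.adjoint (U k) ∘ₗ U k = LinearMap.id) :
    IsLOCC (∑ k, conjBy ((U k).rTensor B') ∘ₗ conjBy ((K k).lTensor A)) := by
  set e := (Fintype.equivFin κ).symm
  have hA : ∀ k, IsLOCC (conjBy ((U k).rTensor B')) := fun k => by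
    have := IsLOCC.alice (A' := A') (B' := B') (n := 1) (fun _ => U k)
      (by simpa [IsKraus] using hU k) (fun _ => LinearMap.id) fun _ => IsLOCC.nil
    simpa using this
  rw [← e.sum_comp]
  refine IsLOCC.bob (fun i => K (e i)) ?_ (fun i => conjBy ((U (e i)).rTensor B'))
    fun i => hA (e i)
  rw [IsKraus, ← hK, ← e.sum_comp]

variable {J : Type*} [Fintype J] [DecidableEq J]

lemma partialTraceA_ketBra {ι : Type*} [Fintype ι] (h : OrthonormalBasis ι ℂ A) (v : A ⊗[ℂ] B) :
    partialTraceA (ketBra v) = ∑ i, ketBra (bra (h i) v) := by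
  rw [partialTraceA_eq h]
  refine Finset.sum_congr rfl fun i _ => ?_
  rw [← conjBy_ketBra (bra (h i)) v, condOp, conjBy, ← bra]
  simp [adjoint_bra]

/-- The Kraus operators by which Bob turns `v j` into a multiple of the vector with the slices
`f i` along the basis `h`, up to a cyclic shift of this basis. -/
def steer {n : ℕ} (h : OrthonormalBasis (Fin n) ℂ A) (f : Fin n → B) (v : A ⊗[ℂ] B) (c : ℝ)
    (s : Fin n) : B →ₗ[ℂ] B :=
  (c : ℂ) • sumRankOne f fun i => bra (h (i + s)) v

/-- Orthogonality of the slices of `τ` makes each term diagonal in the slices of `v`, with unequal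
weights `‖bra (h i) τ‖ ^ 2`. The cyclic shifts average these weights out. -/
lemma sum_adjoint_steer_comp {n : ℕ} [NeZero n] (h : OrthonormalBasis (Fin n) ℂ A) (τ v : A ⊗[ℂ] B)
    (hτ : ∀ i j, i ≠ j → inner ℂ (bra (h i) τ) (bra (h j) τ) = (0 : ℂ)) (c : ℝ) :
    ∑ s, LinearMap.adjoint (steer h (fun i => bra (h i) τ) v c s) ∘ₗ
        steer h (fun i => bra (h i) τ) v c s =
      ((‖τ‖ ^ 2 * c ^ 2 : ℝ) : ℂ) • partialTraceA (ketBra v) := by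
  have h1 : ∀ s, LinearMap.adjoint (steer h (fun i => bra (h i) τ) v c s) ∘ₗ
      steer h (fun i => bra (h i) τ) v c s = ((c ^ 2 : ℝ) : ℂ) •
        ∑ i, ((‖bra (h i) τ‖ ^ 2 : ℝ) : ℂ) • ketBra (bra (h (i + s)) v) := by
    intro s
    rw [steer, map_smulₛₗ, LinearMap.smul_comp, LinearMap.comp_smul,
      adjoint_sumRankOne_comp hτ, smul_smul]
    simp [sq]
  simp_rw [h1]
  rw [← Finset.smul_sum, Finset.sum_comm]
  simp_rw [← Finset.smul_sum]
  have h2 : ∀ i : Fin n, ∑ s, ketBra (bra (h (i + s)) v) = partialTraceA (ketBra v) := fun i => by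
    rw [partialTraceA_ketBra h]
    exact Equiv.sum_comp (Equiv.addLeft i) fun s => ketBra (bra (h s) v)
  simp_rw [h2]
  rw [← Finset.sum_smul, smul_smul, norm_sq_eq_sum_bra h τ]
  push_cast
  rw [mul_comm]

/-- The cyclic shift of a basis by `-s`. -/
def shift {n : ℕ} [NeZero n] (h : OrthonormalBasis (Fin n) ℂ A) (s : Fin n) : A →ₗ[ℂ] A :=
  (h.equiv h (Equiv.subRight s)).toLinearEquiv.toLinearMap

lemma shift_apply {n : ℕ} [NeZero n] (h : OrthonormalBasis (Fin n) ℂ A) (s i : Fin n) :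
    shift h s (h i) = h (i - s) := by
  simp [shift]

lemma adjoint_shift_comp {n : ℕ} [NeZero n] (h : OrthonormalBasis (Fin n) ℂ A) (s : Fin n) :
    LinearMap.adjoint (shift h s) ∘ₗ shift h s = LinearMap.id := by
  refine LinearMap.ext fun x => ext_inner_left ℂ fun y => ?_
  rw [LinearMap.comp_apply, LinearMap.adjoint_inner_right]
  exact (h.equiv h (Equiv.subRight s)).inner_map_map y x

/-- Bob's operator replaces the slice of `v j` at `h i` by a multiple of the slice of `τ` at `h (i -
s)`, and Alice's shift moves `h i` to `h (i - s)`. For `j ≠ k` the slices of `v k` are orthogonal to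
those of `v j` and are annihilated. -/
lemma shift_steer_apply {n : ℕ} [NeZero n] (h : OrthonormalBasis (Fin n) ℂ A) {v : J → A ⊗[ℂ] B}
    {g : J → ℝ} (hv : ∀ ψ φ j k, inner ℂ (bra ψ (v j)) (bra φ (v k)) =
      if j = k then inner ℂ φ ψ * (g j : ℂ) else 0) (τ : A ⊗[ℂ] B) (c : ℝ) (s : Fin n) (j k : J) :
    (shift h s).rTensor B ((steer h (fun i => bra (h i) τ) (v j) c s).lTensor A (v k)) =
      (if j = k then ((c * g j : ℝ) : ℂ) else 0) • τ := by
  conv_lhs => rw [← sum_tmul_bra h (v k)]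
  conv_rhs => rw [← sum_tmul_bra h τ]
  simp only [map_sum, LinearMap.lTensor_tmul, LinearMap.rTensor_tmul, shift_apply]
  rw [Finset.smul_sum, ← Equiv.sum_comp (Equiv.subRight s) fun i =>
    (if j = k then ((c * g j : ℝ) : ℂ) else 0) • h i ⊗ₜ[ℂ] bra (h i) τ]
  refine Finset.sum_congr rfl fun i _ => ?_
  rw [← TensorProduct.tmul_smul, Equiv.subRight_apply]
  congr 1
  rw [steer, LinearMap.smul_apply, sumRankOne_apply, Finset.sum_eq_single (i - s)]
  · rw [hv, sub_add_cancel, h.inner_eq_one, smul_smul, one_mul]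
    split_ifs <;> simp
  · intro i' _ hi'
    rw [hv, h.inner_eq_zero, zero_mul, ite_self, zero_smul]
    rintro rfl
    simp at hi'
  · simp

lemma norm_bra_sq {v : J → A ⊗[ℂ] B} {g : J → ℝ}
    (hv : ∀ ψ φ j k, inner ℂ (bra ψ (v j)) (bra φ (v k)) =
      if j = k then inner ℂ φ ψ * (g j : ℂ) else 0) (ψ : A) (j : J) :
    ‖bra ψ (v j)‖ ^ 2 = ‖ψ‖ ^ 2 * g j := by
  have := hv ψ ψ j j
  rw [if_pos rfl, inner_self_eq_norm_sq_to_K, inner_self_eq_norm_sq_to_K] at this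
  apply Complex.ofReal_injective
  push_cast
  exact this

/-- The state `∑ j, |v j⟩⟨v j|`, where the `v j` are multiples of maximally entangled vectors with
orthogonal supports on Bob's side, is converted to every other state by a measurement of Bob
followed by a unitary of Alice. -/
lemma exists_isLOCC {v : J → A ⊗[ℂ] B} {g : J → ℝ} (hg : ∀ j, 0 ≤ g j)
    (hv : ∀ ψ φ j k, inner ℂ (bra ψ (v j)) (bra φ (v k)) =
      if j = k then inner ℂ φ ψ * (g j : ℂ) else 0)
    (hv1 : ∑ j, ‖v j‖ ^ 2 = 1) {L : Type*} [Fintype L] (τ : L → A ⊗[ℂ] B)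
    (hτ1 : ∑ l, ‖τ l‖ ^ 2 = 1) :
    ∃ Λ : (A ⊗[ℂ] B →ₗ[ℂ] A ⊗[ℂ] B) →ₗ[ℂ] (A ⊗[ℂ] B →ₗ[ℂ] A ⊗[ℂ] B),
      IsLOCC Λ ∧ Λ (∑ j, ketBra (v j)) = ∑ l, ketBra (τ l) := by
  set n := Module.finrank ℂ A with hn
  set h₀ : OrthonormalBasis (Fin n) ℂ A := stdOrthonormalBasis ℂ A
  have hng : (n : ℝ) * ∑ j, g j = 1 := by
    rw [← hv1, Finset.mul_sum]
    refine Finset.sum_congr rfl fun j _ => ?_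
    rw [norm_sq_eq_sum_bra h₀]
    simp [norm_bra_sq hv]
  have : NeZero n := ⟨fun h0 => by simp [h0] at hng⟩
  choose h hh using fun l => exists_schmidt (τ l)
  -- This normalizes the slices of `v j`, so that `P` below is the projection onto the span of all
  -- slices. If `g j = 0`, then `v j = 0` and the default value `c j = 0` does no harm.
  set c : J → ℝ := fun j => (Real.sqrt (g j))⁻¹ with hc
  have hcg : ∀ j, c j * g j = Real.sqrt (g j) := fun j => by
    rw [hc]
    by_cases h0 : Real.sqrt (g j) = 0
    · simp [h0]
    · field_simp
      rw [Real.sq_sqrt (hg j)]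
  set P : B →ₗ[ℂ] B := ∑ j, ((c j ^ 2 : ℝ) : ℂ) • partialTraceA (ketBra (v j)) with hP
  have hPapply : ∀ x, P x = ∑ j, ((c j ^ 2 : ℝ) : ℂ) •
      ∑ i, (inner ℂ (bra (h₀ i) (v j)) x : ℂ) • bra (h₀ i) (v j) := by
    intro x
    simp_rw [hP, partialTraceA_ketBra h₀]
    simp [LinearMap.sum_apply]
  have hPw : ∀ i j, P (bra (h₀ i) (v j)) = bra (h₀ i) (v j) := by
    intro i j
    rw [hPapply, Finset.sum_eq_single j, Finset.sum_eq_single i]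
    · rw [hv, if_pos rfl, h₀.inner_eq_one, one_mul, smul_smul]
      by_cases h0 : g j = 0
      · have := norm_bra_sq hv (h₀ i) j
        rw [h0, mul_zero, sq_eq_zero_iff, norm_eq_zero] at this
        simp [this]
      · have : c j ^ 2 * g j = 1 := by
          rw [hc]
          simp only [inv_pow]
          rw [Real.sq_sqrt (hg j), inv_mul_cancel₀ h0]
        rw [← Complex.ofReal_mul, this, Complex.ofReal_one, one_smul]
    · intro i' _ hi'
      rw [hv, h₀.inner_eq_zero hi'.symm, zero_mul, ite_self, zero_smul]
    · simp
    · intro j' _ hj'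
      simp [hv, hj']
    · simp
  have hPP : P ∘ₗ P = P := by
    ext x
    rw [LinearMap.comp_apply]
    conv_lhs => rw [hPapply x]
    conv_rhs => rw [hPapply x]
    simp only [map_sum, map_smul, hPw]
  have hPadj : LinearMap.adjoint P = P := by
    simp [hP, partialTraceA_ketBra h₀, map_smulₛₗ]
  -- The outcome `none` only completes the measurement: `1 - P` kills every `v j`. The weights `‖τ
  -- l‖ ^ 2`, which sum to one, are already contained in the steering operators.
  set K : Option (J × L × Fin n) → B →ₗ[ℂ] B := fun k => k.elim (LinearMap.id - P) fun p =>
    steer (h p.2.1) (fun i => bra (h p.2.1 i) (τ p.2.1)) (v p.1) (c p.1) p.2.2 with hK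
  set U : Option (J × L × Fin n) → A →ₗ[ℂ] A := fun k => k.elim LinearMap.id fun p =>
    shift (h p.2.1) p.2.2 with hU
  refine ⟨_, isLOCC_bob_alice K ?_ U ?_, ?_⟩
  · have hsome : ∀ j l, ∑ s, LinearMap.adjoint (K (some (j, l, s))) ∘ₗ K (some (j, l, s)) =
        ((‖τ l‖ ^ 2 * c j ^ 2 : ℝ) : ℂ) • partialTraceA (ketBra (v j)) := fun j l =>
      sum_adjoint_steer_comp (h l) (τ l) (v j) (hh l) (c j)
    have hnone : K none = LinearMap.id - P := rfl
    have : ∀ j, ∑ l, ((‖τ l‖ ^ 2 * c j ^ 2 : ℝ) : ℂ) • partialTraceA (ketBra (v j)) =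
        ((c j ^ 2 : ℝ) : ℂ) • partialTraceA (ketBra (v j)) := fun j => by
      rw [← Finset.sum_smul, ← Complex.ofReal_sum, ← Finset.sum_mul, hτ1, one_mul]
    simp_rw [Fintype.sum_option, Fintype.sum_prod_type, hsome, this]
    rw [hnone, ← hP, map_sub, hPadj, LinearMap.adjoint_id, LinearMap.sub_comp, LinearMap.comp_sub,
      LinearMap.comp_sub, hPP]
    simp
  · rintro (_ | p)
    · simp [hU]
    · exact adjoint_shift_comp _ _
  · have hnone : ∀ j, (LinearMap.id - P).lTensor A (v j) = 0 := fun j => by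
      conv_lhs => rw [← sum_tmul_bra h₀ (v j)]
      simp [hPw]
    simp only [LinearMap.sum_apply, LinearMap.comp_apply, map_sum, conjBy_ketBra]
    simp only [Fintype.sum_option, hK, hU, Option.elim, hnone, Fintype.sum_prod_type, shift_steer_apply _ hv,
      map_zero, ketBra_zero, zero_add, ketBra_smul]
    -- Each of the `n` shifts contributes `(c k * g k) ^ 2 = g k`; by `hng` the resulting weights `n
    -- * g k` sum to one.
    have : ∀ k l, ∑ j, ∑ _s : Fin n, ((‖(if j = k then ((c j * g j : ℝ) : ℂ) else 0)‖ ^ 2 : ℝ) : ℂ) •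
        ketBra (τ l) = (n * (g k : ℂ)) • ketBra (τ l) := by
      intro k l
      rw [Finset.sum_eq_single k]
      · rw [if_pos rfl, hcg, Complex.norm_real, Real.norm_eq_abs, sq_abs, Real.sq_sqrt (hg k),
          Finset.sum_const, Finset.card_univ, Fintype.card_fin, ← Nat.cast_smul_eq_nsmul ℂ,
          smul_smul]
      · intro j _ hj
        simp [hj]
      · simp
    rw [Finset.sum_congr rfl fun k _ => Finset.sum_comm, Finset.sum_comm]
    simp_rw [this]
    refine Finset.sum_congr rfl fun l _ => ?_
    rw [← Finset.sum_smul, ← Finset.mul_sum]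
    have : (n : ℂ) * ∑ j, (g j : ℂ) = 1 := by exact_mod_cast congrArg Complex.ofReal hng
    rw [this, one_smul]

end Protocol

/-! ### From proportional Gram operators to maximal entanglement. -/

section SubnormalizedMES

universe u v

variable {A : Type u} {B : Type v} {E : Type*} [NormedAddCommGroup A] [InnerProductSpace ℂ A]
  [FiniteDimensional ℂ A] [NormedAddCommGroup B] [InnerProductSpace ℂ B] [FiniteDimensional ℂ B]
  [NormedAddCommGroup E] [InnerProductSpace ℂ E] [FiniteDimensional ℂ E]

/-- If the slices of `R` satisfy `R_ψ† R_φ = ⟨φ, ψ⟩ G`, then `R R†` is maximally entangled. -/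
lemma isMES_comp_adjoint {R : E →ₗ[ℂ] A ⊗[ℂ] B} {G : E →ₗ[ℂ] E}
    (hG : ∀ ψ φ e e', inner ℂ (bra ψ (R e)) (bra φ (R e')) = inner ℂ φ ψ * inner ℂ e (G e'))
    (htr : LinearMap.trace ℂ _ (R ∘ₗ LinearMap.adjoint R) = 1) :
    IsMES (R ∘ₗ LinearMap.adjoint R) := by
  refine ⟨⟨LinearMap.isPositive_self_comp_adjoint R, htr⟩, fun σ hσ => ?_⟩
  have hA : ∃ ψ : A, ‖ψ‖ = 1 := by
    by_contra! hcon
    have hz : ∀ ψ : A, ψ = 0 := fun ψ => by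
      by_contra h0
      exact hcon ((‖ψ‖⁻¹ : ℂ) • ψ) (by simp [norm_smul, norm_ne_zero_iff.2 h0])
    have hR : R = 0 := by
      ext e
      rw [← sum_tmul_bra (stdOrthonormalBasis ℂ A) (R e)]
      simp [hz (stdOrthonormalBasis ℂ A _)]
    simp [hR] at htr
  obtain ⟨ψ₀, hψ₀⟩ := hA
  have hGpos : G.IsPositive := by
    -- A unit vector `ψ₀` exhibits `G` as a Gram operator, hence positive. In its eigenbasis `e` the
    -- vectors `R (e j)` meet the hypothesis of `exists_isLOCC`.
    have : G = LinearMap.adjoint (bra ψ₀ ∘ₗ R) ∘ₗ (bra ψ₀ ∘ₗ R) := by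
      refine LinearMap.ext fun e' => ext_inner_left ℂ fun e => ?_
      rw [LinearMap.comp_apply, LinearMap.adjoint_inner_right, LinearMap.comp_apply,
        LinearMap.comp_apply, hG, inner_self_eq_norm_sq_to_K, hψ₀]
      simp
    rw [this]
    exact LinearMap.isPositive_adjoint_comp_self _
  set e := hGpos.isSymmetric.eigenvectorBasis rfl
  obtain ⟨S, hS⟩ := exists_comp_adjoint hσ.1
  have he := comp_adjoint_eq_sum_ketBra e R
  set f := stdOrthonormalBasis ℂ (A ⊗[ℂ] B)
  rw [he, hS, comp_adjoint_eq_sum_ketBra f S]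
  refine exists_isLOCC (g := hGpos.isSymmetric.eigenvalues rfl)
    (hGpos.nonneg_eigenvalues rfl) (fun ψ φ j k => ?_) ?_ _ ?_
  · rw [hG, hGpos.isSymmetric.apply_eigenvectorBasis, inner_smul_right, e.inner_eq_ite]
    split_ifs with h
    · rw [h, mul_one]
      rfl
    · simp
  · rw [trace_comp_adjoint e] at htr
    exact_mod_cast htr
  · have h2 := hσ.2
    rw [hS, trace_comp_adjoint f] at h2
    exact_mod_cast h2

lemma isSubnormalizedMES_comp_adjoint {R : E →ₗ[ℂ] A ⊗[ℂ] B} {G : E →ₗ[ℂ] E}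
    (hG : ∀ ψ φ e e', inner ℂ (bra ψ (R e)) (bra φ (R e')) = inner ℂ φ ψ * inner ℂ e (G e'))
    (htr0 : 0 < (LinearMap.trace ℂ _ (R ∘ₗ LinearMap.adjoint R)).re)
    (htr1 : (LinearMap.trace ℂ _ (R ∘ₗ LinearMap.adjoint R)).re ≤ 1) :
    IsSubnormalizedMES (R ∘ₗ LinearMap.adjoint R) := by
  set q := (LinearMap.trace ℂ _ (R ∘ₗ LinearMap.adjoint R)).re with hq
  have hqtr : LinearMap.trace ℂ _ (R ∘ₗ LinearMap.adjoint R) = q := by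
    rw [hq, trace_comp_adjoint (stdOrthonormalBasis ℂ E), Complex.ofReal_re]
  set c : ℂ := (((Real.sqrt q)⁻¹ : ℝ) : ℂ) with hc
  have hcc : c * c = (q : ℂ)⁻¹ := by
    rw [hc, ← Complex.ofReal_mul, ← mul_inv, Real.mul_self_sqrt htr0.le, Complex.ofReal_inv]
  have hcR : (c • R) ∘ₗ LinearMap.adjoint (c • R) = (q : ℂ)⁻¹ • (R ∘ₗ LinearMap.adjoint R) := by
    rw [map_smulₛₗ, LinearMap.smul_comp, LinearMap.comp_smul, smul_smul, ← hcc]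
    simp [hc]
  have hq0 : (q : ℂ) ≠ 0 := by exact_mod_cast htr0.ne'
  refine ⟨q, (c • R) ∘ₗ LinearMap.adjoint (c • R), htr0, htr1,
    isMES_comp_adjoint (G := (q : ℂ)⁻¹ • G) (fun ψ φ e e' => ?_) ?_, ?_⟩
  · rw [LinearMap.smul_apply, LinearMap.smul_apply, LinearMap.smul_apply, map_smul, map_smul,
      inner_smul_left, inner_smul_right, inner_smul_right, hG, ← hcc]
    simp only [hc, Complex.conj_ofReal]
    ring
  · rw [hcR, map_smul, hqtr, smul_eq_mul, inv_mul_cancel₀ hq0]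
  · rw [hcR, smul_smul, mul_inv_cancel₀ hq0, one_smul]

end SubnormalizedMES

/-! ### Perfect guessing and orthogonality of slices. -/

section Guess

variable {A B E : Type*} [NormedAddCommGroup A] [InnerProductSpace ℂ A]
  [FiniteDimensional ℂ A] [NormedAddCommGroup B] [InnerProductSpace ℂ B] [FiniteDimensional ℂ B]
  [NormedAddCommGroup E] [InnerProductSpace ℂ E] [FiniteDimensional ℂ E] {d : ℕ}

lemma guessProb_comp_adjoint (ψ : OrthonormalBasis (Fin d) ℂ A) (M : Fin d → (B →ₗ[ℂ] B))
    (R : E →ₗ[ℂ] A ⊗[ℂ] B) :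
    guessProb ψ M (R ∘ₗ LinearMap.adjoint R) = ∑ k, LinearMap.trace ℂ B
      (((bra (ψ k) ∘ₗ R) ∘ₗ LinearMap.adjoint (bra (ψ k) ∘ₗ R)) ∘ₗ M k) := by
  simp_rw [guessProb, trace_comp_map_ketBra, condOp_comp_adjoint]

/-- A measurement distinguishes the ensemble `S k S k†` perfectly only if the operators `S k`
have orthogonal ranges. -/
lemma adjoint_comp_eq_zero_of_guess {S : Fin d → E →ₗ[ℂ] B} {M : Fin d → B →ₗ[ℂ] B}
    (hM : IsPOVM M)
    (h : ∑ k, LinearMap.trace ℂ B ((S k ∘ₗ LinearMap.adjoint (S k)) ∘ₗ M k) =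
      ∑ k, LinearMap.trace ℂ B (S k ∘ₗ LinearMap.adjoint (S k))) {k l : Fin d} (hkl : k ≠ l) :
    LinearMap.adjoint (S k) ∘ₗ S l = 0 := by
  choose Q hQ using fun k => exists_comp_adjoint (hM.1 k)
  have htr : ∀ k l, LinearMap.trace ℂ B ((S k ∘ₗ LinearMap.adjoint (S k)) ∘ₗ M l) =
      LinearMap.trace ℂ E ((LinearMap.adjoint (S k) ∘ₗ Q l) ∘ₗ
        LinearMap.adjoint (LinearMap.adjoint (S k) ∘ₗ Q l)) := by
    intro k l
    rw [LinearMap.comp_assoc, LinearMap.trace_comp_comm', hQ, LinearMap.adjoint_comp,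
      LinearMap.adjoint_adjoint]
    simp only [LinearMap.comp_assoc]
  have hsum : ∀ k, LinearMap.trace ℂ B (S k ∘ₗ LinearMap.adjoint (S k)) =
      ∑ l, LinearMap.trace ℂ B ((S k ∘ₗ LinearMap.adjoint (S k)) ∘ₗ M l) := by
    intro k
    rw [← map_sum]
    congr 1
    refine LinearMap.ext fun v => ?_
    have := LinearMap.congr_fun hM.2 v
    rw [LinearMap.sum_apply] at this ⊢
    simp only [LinearMap.comp_apply, ← map_sum, this, LinearMap.id_apply]
  have hnn : ∀ k l, 0 ≤ (LinearMap.trace ℂ B ((S k ∘ₗ LinearMap.adjoint (S k)) ∘ₗ M l)).re :=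
    fun k l => by rw [htr]; exact re_trace_comp_adjoint_nonneg _
  -- Certainty leaves no weight for wrong guesses; each of these weights is a squared
  -- Hilbert–Schmidt norm of `S k† Q l`.
  have hzero : ∀ k l, k ≠ l → LinearMap.adjoint (S k) ∘ₗ Q l = 0 := by
    have h1 : ∀ k ∈ Finset.univ,
        (LinearMap.trace ℂ B ((S k ∘ₗ LinearMap.adjoint (S k)) ∘ₗ M k)).re ≤
        ∑ l, (LinearMap.trace ℂ B ((S k ∘ₗ LinearMap.adjoint (S k)) ∘ₗ M l)).re := fun k _ =>
      Finset.single_le_sum (f := fun l =>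
        (LinearMap.trace ℂ B ((S k ∘ₗ LinearMap.adjoint (S k)) ∘ₗ M l)).re)
        (fun l _ => hnn k l) (Finset.mem_univ k)
    simp_rw [hsum] at h
    have h2 := congrArg Complex.re h
    simp only [Complex.re_sum] at h2
    intro k l hkl
    have h3 := (Finset.sum_eq_sum_iff_of_le h1).1 h2 k (Finset.mem_univ k)
    rw [← Finset.add_sum_erase _ _ (Finset.mem_univ k), left_eq_add,
      Finset.sum_eq_zero_iff_of_nonneg fun l _ => hnn k l] at h3
    have h4 := h3 l (Finset.mem_erase.2 ⟨hkl.symm, Finset.mem_univ l⟩)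
    rw [htr] at h4
    exact eq_zero_of_trace_comp_adjoint h4
  have hMS : ∀ j l, j ≠ l → ∀ e, M j (S l e) = 0 := by
    intro j l hjl e
    have := congrArg LinearMap.adjoint (hzero l j hjl.symm)
    rw [LinearMap.adjoint_comp, LinearMap.adjoint_adjoint, map_zero] at this
    rw [hQ, LinearMap.comp_apply, ← LinearMap.comp_apply (LinearMap.adjoint (Q j)) (S l), this]
    simp
  have hSM : ∀ e, M k (S k e) = S k e := by
    intro e
    have := LinearMap.congr_fun hM.2 (S k e)
    rw [LinearMap.sum_apply, Finset.sum_eq_single k (fun j _ hj => hMS j k hj e) (by simp)] at this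
    exact this
  refine LinearMap.ext fun e => ext_inner_left ℂ fun e' => ?_
  rw [LinearMap.comp_apply, LinearMap.adjoint_inner_right, ← hSM, (hM.1 k).isSymmetric,
    hMS k l hkl]
  simp

/-- Operators with orthogonal ranges are perfectly distinguished by a projective measurement. -/
lemma exists_isPOVM_of_adjoint_comp_eq_zero {S : Fin d → E →ₗ[ℂ] B} (k₀ : Fin d)
    (hS : ∀ k l, k ≠ l → LinearMap.adjoint (S k) ∘ₗ S l = 0) :
    ∃ M : Fin d → B →ₗ[ℂ] B, IsPOVM M ∧ ∀ k, M k ∘ₗ S k = S k := by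
  set P : Fin d → B →ₗ[ℂ] B := fun k => ((LinearMap.range (S k)).starProjection : B →ₗ[ℂ] B) with hP
  have hPS : ∀ k, (P k).IsSymmetricProjection := fun k =>
    Submodule.isSymmetricProjection_starProjection _
  have hort : ∀ k l, k ≠ l → LinearMap.range (S k) ⟂ LinearMap.range (S l) := by
    intro k l hkl
    rw [Submodule.isOrtho_iff_inner_eq]
    rintro _ ⟨e, rfl⟩ _ ⟨e', rfl⟩
    rw [← LinearMap.adjoint_inner_right, ← LinearMap.comp_apply, hS k l hkl]
    simp
  have hPP : ∀ k l, k ≠ l → P k ∘ₗ P l = 0 := fun k l hkl => by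
    have := (hort k l hkl).starProjection_comp_starProjection
    ext x
    exact DFunLike.congr_fun this x
  have hid : ∀ k, P k ∘ₗ P k = P k := fun k => (hPS k).isIdempotentElem
  have hself : ∀ k e, P k (S k e) = S k e := fun k e =>
    Submodule.starProjection_eq_self_iff.2 ⟨e, rfl⟩
  have hother : ∀ k l e, k ≠ l → P k (S l e) = 0 := fun k l e hkl => by
    rw [← hself l e, ← LinearMap.comp_apply, hPP k l hkl, LinearMap.zero_apply]
  set Q : B →ₗ[ℂ] B := LinearMap.id - ∑ k, P k with hQ
  have hsumsum : (∑ k, P k) ∘ₗ (∑ k, P k) = ∑ k, P k := by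
    refine LinearMap.ext fun x => ?_
    rw [LinearMap.comp_apply, LinearMap.sum_apply, LinearMap.sum_apply]
    refine Finset.sum_congr rfl fun k _ => ?_
    rw [map_sum, Finset.sum_eq_single k]
    · rw [← LinearMap.comp_apply, hid]
    · intro l _ hl
      rw [← LinearMap.comp_apply, hPP k l hl.symm, LinearMap.zero_apply]
    · simp
  have hQpos : Q.IsPositive := by
    have hQidem : IsIdempotentElem Q := by
      have : Q ∘ₗ Q = Q := by
        rw [hQ, LinearMap.sub_comp, LinearMap.comp_sub, LinearMap.comp_sub, hsumsum]
        simp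
      exact this
    rw [LinearMap.IsIdempotentElem.isPositive_iff_isSymmetric hQidem]
    exact LinearMap.IsSymmetric.id.sub
      (LinearMap.isPositive_sum _ fun k _ => (hPS k).isPositive).isSymmetric
  -- The leftover projection `Q` annihilates all ranges, so it may be attached to any outcome; `k₀`
  -- receives it.
  refine ⟨fun k => P k + if k = k₀ then Q else 0, ⟨fun k => (hPS k).isPositive.add ?_, ?_⟩,
    fun k => LinearMap.ext fun e => ?_⟩
  · split_ifs
    exacts [hQpos, LinearMap.isPositive_zero]
  · rw [Finset.sum_add_distrib, Finset.sum_ite_eq' Finset.univ k₀, if_pos (Finset.mem_univ _), hQ]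
    simp
  · have hQS : Q (S k e) = 0 := by
      rw [hQ, LinearMap.sub_apply, LinearMap.sum_apply, Finset.sum_eq_single k
        (fun j _ hj => hother j k e hj) (by simp), hself]
      simp
    rw [LinearMap.comp_apply, LinearMap.add_apply, hself]
    split_ifs
    · rw [hQS, add_zero]
    · simp

variable {m : ℕ}

/-- `R R†` is a zero-uncertainty state iff, for each basis, the slices of `R` along different
basis vectors have orthogonal ranges. -/
lemma isZUS_iff_inner_bra (ℬ : Fin m → OrthonormalBasis (Fin d) ℂ A) {R : E →ₗ[ℂ] A ⊗[ℂ] B}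
    (hR : LinearMap.trace ℂ _ (R ∘ₗ LinearMap.adjoint R) = 1) :
    IsZUS ℬ (R ∘ₗ LinearMap.adjoint R) ↔ ∀ x k l, k ≠ l → ∀ e e',
      inner ℂ (bra (ℬ x k) (R e)) (bra (ℬ x l) (R e')) = (0 : ℂ) := by
  have htr : ∀ x, ∑ k, LinearMap.trace ℂ B ((bra (ℬ x k) ∘ₗ R) ∘ₗ
      LinearMap.adjoint (bra (ℬ x k) ∘ₗ R)) = 1 := fun x => by
    rw [← hR, trace_eq_sum_condOp (ℬ x)]
    simp_rw [condOp_comp_adjoint]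
  refine forall_congr' fun x => ⟨?_, fun h => ?_⟩
  · rintro ⟨M, hM, h⟩ k l hkl e e'
    rw [guessProb_comp_adjoint, ← htr x] at h
    have := LinearMap.congr_fun (adjoint_comp_eq_zero_of_guess hM h hkl) e'
    rw [← LinearMap.comp_apply, ← LinearMap.comp_apply, ← LinearMap.adjoint_inner_right,
      ← LinearMap.comp_apply (LinearMap.adjoint _), this]
    simp
  · have hd : Nonempty (Fin d) := by
      by_contra hd
      rw [not_nonempty_iff] at hd
      simpa using htr x
    obtain ⟨M, hM, hMS⟩ := exists_isPOVM_of_adjoint_comp_eq_zero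
      (S := fun k => bra (ℬ x k) ∘ₗ R) hd.some fun k l hkl => by
        refine LinearMap.ext fun e' => ext_inner_left ℂ fun e => ?_
        rw [LinearMap.comp_apply, LinearMap.adjoint_inner_right, LinearMap.comp_apply,
          LinearMap.comp_apply, h k l hkl]
        simp
    refine ⟨M, hM, ?_⟩
    rw [guessProb_comp_adjoint, ← htr x]
    refine Finset.sum_congr rfl fun k _ => ?_
    rw [LinearMap.trace_comp_comm', ← LinearMap.comp_assoc, hMS k]

end Guess

/-! ### Rank bound and supports in terms of slices. -/

section Slices

/-- The operator `(J† ⊗ 1) R`. -/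
def pullbackA {A K B E : Type*} [NormedAddCommGroup A] [InnerProductSpace ℂ A]
    [FiniteDimensional ℂ A] [NormedAddCommGroup K] [InnerProductSpace ℂ K] [FiniteDimensional ℂ K]
    [NormedAddCommGroup B] [InnerProductSpace ℂ B] [NormedAddCommGroup E] [InnerProductSpace ℂ E]
    (J : K →ₗ[ℂ] A) (R : E →ₗ[ℂ] A ⊗[ℂ] B) : E →ₗ[ℂ] K ⊗[ℂ] B :=
  (LinearMap.adjoint J).rTensor B ∘ₗ R

variable {A B E : Type*} [NormedAddCommGroup A] [InnerProductSpace ℂ A]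
  [FiniteDimensional ℂ A] [NormedAddCommGroup B] [InnerProductSpace ℂ B] [FiniteDimensional ℂ B]
  [NormedAddCommGroup E] [InnerProductSpace ℂ E] [FiniteDimensional ℂ E]

lemma finrank_le_of_inner_bra {R : E →ₗ[ℂ] A ⊗[ℂ] B} {G : E →ₗ[ℂ] E}
    (hG : ∀ ψ φ e e', inner ℂ (bra ψ (R e)) (bra φ (R e')) = inner ℂ φ ψ * inner ℂ e (G e'))
    (hR : R ≠ 0) : Module.finrank ℂ A ≤ Module.finrank ℂ B := by
  obtain ⟨e, he⟩ : ∃ e, R e ≠ 0 := by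
    by_contra! hcon
    exact hR (LinearMap.ext hcon)
  set h := stdOrthonormalBasis ℂ A
  have hγ : (inner ℂ e (G e) : ℂ) ≠ 0 := by
    intro h0
    apply he
    have hz : ∀ i, bra (h i) (R e) = 0 := fun i => by
      rw [← inner_self_eq_zero (𝕜 := ℂ), hG, h0, mul_zero]
    rw [← sum_tmul_bra h (R e)]
    simp [hz]
  have hli : LinearIndependent ℂ fun i => bra (h i) (R e) := by
    refine linearIndependent_of_ne_zero_of_inner_eq_zero (fun i h0 => ?_) fun i j hij => ?_
    · have := hG (h i) (h i) e e
      rw [h0, inner_zero_left, h.inner_eq_one, one_mul] at this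
      exact hγ this.symm
    · change inner ℂ (bra (h i) (R e)) (bra (h j) (R e)) = (0 : ℂ)
      rw [hG, h.inner_eq_zero hij.symm, zero_mul]
  simpa using hli.fintype_card_le_finrank

/-- The expectation of the sum in `z` is `∑ i, ‖S i† z‖ ^ 2`, so the kernel consists of the vectors
orthogonal to every range. -/
lemma support_sum_comp_adjoint {ι : Type*} [Fintype ι] (S : ι → E →ₗ[ℂ] B) :
    support (∑ i, S i ∘ₗ LinearMap.adjoint (S i)) = ⨆ i, LinearMap.range (S i) := by
  have : LinearMap.ker (∑ i, S i ∘ₗ LinearMap.adjoint (S i)) = (⨆ i, LinearMap.range (S i))ᗮ := by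
    rw [← Submodule.iInf_orthogonal]
    simp_rw [LinearMap.orthogonal_range]
    ext z
    rw [LinearMap.mem_ker, Submodule.mem_iInf, LinearMap.sum_apply]
    constructor
    · intro h0 i
      have h1 : inner ℂ z (∑ i, (S i ∘ₗ LinearMap.adjoint (S i)) z) = (0 : ℂ) := by
        rw [h0, inner_zero_right]
      have h2 : ∑ i, ‖LinearMap.adjoint (S i) z‖ ^ 2 = 0 := by
        apply Complex.ofReal_injective
        rw [inner_sum] at h1
        have h3 : ∀ i, inner ℂ z ((S i ∘ₗ LinearMap.adjoint (S i)) z) =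
            ((‖LinearMap.adjoint (S i) z‖ ^ 2 : ℝ) : ℂ) := fun i => by
          rw [LinearMap.comp_apply, ← LinearMap.adjoint_inner_left, inner_self_eq_norm_sq_to_K]
          push_cast
          rfl
        simp_rw [h3] at h1
        exact_mod_cast h1
      rw [Finset.sum_eq_zero_iff_of_nonneg fun i _ => by positivity] at h2
      simpa using h2 i (Finset.mem_univ i)
    · intro h0
      refine Finset.sum_eq_zero fun i _ => ?_
      rw [LinearMap.comp_apply, LinearMap.mem_ker.1 (h0 i), map_zero]
  rw [support, this, Submodule.orthogonal_orthogonal]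

end Slices

/-! ### Component subspaces, projectors and component states. -/

section Components

universe u v

variable {HA : Type u} {HB : Type v}
  [NormedAddCommGroup HA] [InnerProductSpace ℂ HA] [FiniteDimensional ℂ HA]
  [NormedAddCommGroup HB] [InnerProductSpace ℂ HB] [FiniteDimensional ℂ HB]
  {E : Type*} [NormedAddCommGroup E] [InnerProductSpace ℂ E] [FiniteDimensional ℂ E]
  {m d : ℕ} (ℬ : Fin m → OrthonormalBasis (Fin d) ℂ HA) (x : Fin m) (a : Component ℬ)

lemma mem_supp_of_inner_ne_zero {p q : Fin m × Fin d} (hp : p ∈ a.supp)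
    (h : inner ℂ (ℬ p.1 p.2) (ℬ q.1 q.2) ≠ (0 : ℂ)) : q ∈ a.supp := by
  by_cases hpq : p = q
  · exact hpq ▸ hp
  · have hadj : (transitionGraph ℬ).Adj p q := ⟨hpq, h⟩
    rw [SimpleGraph.ConnectedComponent.mem_supp_iff] at hp ⊢
    rw [← hp]
    exact SimpleGraph.ConnectedComponent.sound hadj.symm.reachable

-- Independence of the basis index: a basis state of the component overlaps only with those states
-- of `ℬ x` that lie in the same component.
variable {a} in
lemma apply_mem_componentSubspace {y : Fin m} {k : Fin d} (h : (y, k) ∈ a.supp) :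
    ℬ y k ∈ componentSubspace ℬ x a := by
  rw [← (ℬ x).sum_repr' (ℬ y k)]
  refine Submodule.sum_mem _ fun l _ => ?_
  by_cases h0 : inner ℂ (ℬ x l) (ℬ y k) = (0 : ℂ)
  · rw [h0, zero_smul]
    exact Submodule.zero_mem _
  · exact Submodule.smul_mem _ _ (Submodule.subset_span ⟨l, mem_supp_of_inner_ne_zero ℬ a h
      (fun h1 => h0 (inner_eq_zero_symm.1 h1)), rfl⟩)

variable {a} in
lemma inner_eq_zero_of_mem_componentSubspace {y : Fin m} {k : Fin d} (h : (y, k) ∉ a.supp)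
    {ψ : HA} (hψ : ψ ∈ componentSubspace ℬ x a) : inner ℂ (ℬ y k) ψ = (0 : ℂ) := by
  induction hψ using Submodule.span_induction with
  | mem ψ hψ =>
    obtain ⟨l, hl, rfl⟩ := hψ
    by_contra h0
    exact h (mem_supp_of_inner_ne_zero ℬ a hl fun h1 => h0 (inner_eq_zero_symm.1 h1))
  | zero => exact inner_zero_right _
  | add ψ φ _ _ h1 h2 => rw [inner_add_right, h1, h2, add_zero]
  | smul c ψ _ h1 => rw [inner_smul_right, h1, mul_zero]

lemma adjoint_componentProj :
    LinearMap.adjoint (componentProj ℬ x a) = componentProj ℬ x a := by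
  simp [componentProj]

lemma componentProj_mem (ψ : HA) : componentProj ℬ x a ψ ∈ componentSubspace ℬ x a := by
  classical
  rw [componentProj, LinearMap.sum_apply]
  refine Submodule.sum_mem _ fun k hk => ?_
  rw [ketBra_apply]
  exact Submodule.smul_mem _ _ (Submodule.subset_span ⟨k, (Finset.mem_filter.1 hk).2, rfl⟩)

variable {a} in
lemma componentProj_of_mem {ψ : HA} (hψ : ψ ∈ componentSubspace ℬ x a) :
    componentProj ℬ x a ψ = ψ := by
  classical
  conv_rhs => rw [← (ℬ x).sum_repr' ψ]
  rw [componentProj, LinearMap.sum_apply, Finset.sum_filter]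
  refine Finset.sum_congr rfl fun k _ => ?_
  split_ifs with h
  · rfl
  · rw [inner_eq_zero_of_mem_componentSubspace ℬ x h hψ, zero_smul]

variable {a} in
lemma componentProj_of_not_mem {k : Fin d} (h : (x, k) ∉ a.supp) :
    componentProj ℬ x a (ℬ x k) = 0 := by
  refine ext_inner_left ℂ fun φ => ?_
  rw [← LinearMap.adjoint_inner_left, adjoint_componentProj, inner_zero_right]
  exact inner_eq_zero_symm.1
    (inner_eq_zero_of_mem_componentSubspace ℬ x h (componentProj_mem ℬ x a φ))

lemma componentRank_eq :
    componentRank ℬ x a = Module.finrank ℂ (componentSubspace ℬ x a) := by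
  have : LinearMap.IsProj (componentSubspace ℬ x a) (componentProj ℬ x a) :=
    ⟨componentProj_mem ℬ x a, fun _ h => componentProj_of_mem ℬ x h⟩
  rw [componentRank, this.trace, Complex.natCast_re]

/-- The factor `R_a` of the component state `ρ_a = R_a R_a†`, regarded as an operator into
`H_{A,a} ⊗ H_B`. -/
def componentFactor (R : E →ₗ[ℂ] HA ⊗[ℂ] HB) :=
  pullbackA (componentSubspace ℬ x a).subtype R

lemma bra_componentFactor (R : E →ₗ[ℂ] HA ⊗[ℂ] HB) (ψ : componentSubspace ℬ x a) (e : E) :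
    bra ψ (componentFactor ℬ x a R e) = bra (ψ : HA) (R e) := by
  rw [componentFactor, pullbackA, LinearMap.comp_apply, bra_rTensor, LinearMap.adjoint_adjoint]
  rfl

lemma componentState_comp_adjoint (R : E →ₗ[ℂ] HA ⊗[ℂ] HB) :
    componentState ℬ x (R ∘ₗ LinearMap.adjoint R) a =
      ((componentProj ℬ x a).rTensor HB ∘ₗ R) ∘ₗ
        LinearMap.adjoint ((componentProj ℬ x a).rTensor HB ∘ₗ R) := by
  rw [← conjBy_comp_adjoint, componentState, conjBy]
  simp [adjoint_componentProj]

lemma adjoint_subtype_comp_componentProj :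
    LinearMap.adjoint (componentSubspace ℬ x a).subtype ∘ₗ componentProj ℬ x a =
      LinearMap.adjoint (componentSubspace ℬ x a).subtype := by
  have : componentProj ℬ x a ∘ₗ (componentSubspace ℬ x a).subtype =
      (componentSubspace ℬ x a).subtype :=
    LinearMap.ext fun ψ => componentProj_of_mem ℬ x ψ.2
  have := congrArg LinearMap.adjoint this
  rwa [LinearMap.adjoint_comp, adjoint_componentProj] at this

lemma subtype_comp_adjoint_subtype :
    (componentSubspace ℬ x a).subtype ∘ₗ LinearMap.adjoint (componentSubspace ℬ x a).subtype =
      componentProj ℬ x a := by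
  refine LinearMap.ext fun ψ => ?_
  rw [← adjoint_subtype_comp_componentProj]
  simp only [LinearMap.comp_apply]
  have hiso : ∀ φ : componentSubspace ℬ x a,
      LinearMap.adjoint (componentSubspace ℬ x a).subtype (φ : HA) = φ := fun φ =>
    ext_inner_left ℂ fun χ => by rw [LinearMap.adjoint_inner_right]; rfl
  exact congrArg Subtype.val (hiso ⟨componentProj ℬ x a ψ, componentProj_mem ℬ x a ψ⟩)

lemma restrictA_componentState (R : E →ₗ[ℂ] HA ⊗[ℂ] HB) :
    restrictA (componentSubspace ℬ x a) (componentState ℬ x (R ∘ₗ LinearMap.adjoint R) a) =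
      componentFactor ℬ x a R ∘ₗ LinearMap.adjoint (componentFactor ℬ x a R) := by
  rw [componentState_comp_adjoint, restrictA, conjBy_comp_adjoint, ← LinearMap.comp_assoc,
    ← LinearMap.rTensor_comp, adjoint_subtype_comp_componentProj]
  rfl

/-- By cyclicity both traces are that of `R† (P_a ⊗ 1) R`. -/
lemma trace_componentFactor (R : E →ₗ[ℂ] HA ⊗[ℂ] HB) :
    LinearMap.trace ℂ _
      (componentFactor ℬ x a R ∘ₗ LinearMap.adjoint (componentFactor ℬ x a R)) =
      LinearMap.trace ℂ _ (componentState ℬ x (R ∘ₗ LinearMap.adjoint R) a) := by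
  have hPP : componentProj ℬ x a ∘ₗ componentProj ℬ x a = componentProj ℬ x a :=
    LinearMap.ext fun ψ => componentProj_of_mem ℬ x (componentProj_mem ℬ x a ψ)
  have hl : LinearMap.adjoint (componentFactor ℬ x a R) ∘ₗ componentFactor ℬ x a R =
      LinearMap.adjoint R ∘ₗ (componentProj ℬ x a).rTensor HB ∘ₗ R := by
    rw [← subtype_comp_adjoint_subtype, LinearMap.rTensor_comp, componentFactor, pullbackA,
      LinearMap.adjoint_comp, LinearMap.adjoint_rTensor, LinearMap.adjoint_adjoint]
    simp only [LinearMap.comp_assoc]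
  have hr : LinearMap.adjoint ((componentProj ℬ x a).rTensor HB ∘ₗ R) ∘ₗ
      ((componentProj ℬ x a).rTensor HB ∘ₗ R) =
      LinearMap.adjoint R ∘ₗ (componentProj ℬ x a).rTensor HB ∘ₗ R := by
    rw [LinearMap.adjoint_comp, LinearMap.adjoint_rTensor, adjoint_componentProj]
    conv_rhs => rw [← hPP, LinearMap.rTensor_comp]
    simp only [LinearMap.comp_assoc]
  rw [componentState_comp_adjoint, LinearMap.trace_comp_comm', hl, ← hr, LinearMap.trace_comp_comm']

lemma condOp_componentState (R : E →ₗ[ℂ] HA ⊗[ℂ] HB) (ψ : HA) :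
    condOp ψ (componentState ℬ x (R ∘ₗ LinearMap.adjoint R) a) =
      (bra (componentProj ℬ x a ψ) ∘ₗ R) ∘ₗ
        LinearMap.adjoint (bra (componentProj ℬ x a ψ) ∘ₗ R) := by
  have : bra ψ ∘ₗ (componentProj ℬ x a).rTensor HB ∘ₗ R = bra (componentProj ℬ x a ψ) ∘ₗ R :=
    LinearMap.ext fun e => by
      rw [LinearMap.comp_apply, LinearMap.comp_apply, bra_rTensor, adjoint_componentProj]
      rfl
  rw [componentState_comp_adjoint, condOp_comp_adjoint, this]

lemma re_trace_componentState_le (R : E →ₗ[ℂ] HA ⊗[ℂ] HB) :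
    (LinearMap.trace ℂ _ (componentState ℬ x (R ∘ₗ LinearMap.adjoint R) a)).re ≤
      (LinearMap.trace ℂ _ (R ∘ₗ LinearMap.adjoint R)).re := by
  rw [trace_eq_sum_condOp (ℬ x), trace_eq_sum_condOp (ℬ x) (R ∘ₗ LinearMap.adjoint R),
    Complex.re_sum, Complex.re_sum]
  refine Finset.sum_le_sum fun k _ => ?_
  rw [condOp_componentState, condOp_comp_adjoint]
  by_cases h : (x, k) ∈ a.supp
  · rw [componentProj_of_mem ℬ x (apply_mem_componentSubspace ℬ x h)]
  · rw [componentProj_of_not_mem ℬ x h]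
    simpa using re_trace_comp_adjoint_nonneg (bra (ℬ x k) ∘ₗ R)

lemma support_partialTraceA_componentState (R : E →ₗ[ℂ] HA ⊗[ℂ] HB) :
    support (partialTraceA (componentState ℬ x (R ∘ₗ LinearMap.adjoint R) a)) =
      ⨆ k, LinearMap.range (bra (componentProj ℬ x a (ℬ x k)) ∘ₗ R) := by
  rw [partialTraceA_eq (ℬ x)]
  simp_rw [condOp_componentState]
  exact support_sum_comp_adjoint _

variable {a} in
lemma bra_mem_support (R : E →ₗ[ℂ] HA ⊗[ℂ] HB) {ψ : HA} (hψ : ψ ∈ componentSubspace ℬ x a)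
    (e : E) : bra ψ (R e) ∈
      support (partialTraceA (componentState ℬ x (R ∘ₗ LinearMap.adjoint R) a)) := by
  rw [support_partialTraceA_componentState, ← componentProj_of_mem ℬ x hψ,
    ← (ℬ x).sum_repr' ψ, map_sum, bra_sum, LinearMap.sum_apply]
  refine Submodule.sum_mem _ fun k _ => ?_
  rw [map_smul, bra_smul, LinearMap.smul_apply]
  exact Submodule.smul_mem _ _ (Submodule.mem_iSup_of_mem k ⟨e, rfl⟩)

/-! ### Gram operators of a zero-uncertainty state are constant on components. -/

section ZUS

variable {ℬ} {R : E →ₗ[ℂ] HA ⊗[ℂ] HB}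
  (h : ∀ x k l, k ≠ l → ∀ e e', inner ℂ (bra (ℬ x k) (R e)) (bra (ℬ x l) (R e')) = (0 : ℂ))

include h

lemma inner_bra_eq_sum (ψ φ : HA) (e e' : E) :
    inner ℂ (bra ψ (R e)) (bra φ (R e')) = ∑ k, inner ℂ φ (ℬ x k) * inner ℂ (ℬ x k) ψ *
      inner ℂ (bra (ℬ x k) (R e)) (bra (ℬ x k) (R e')) := by
  conv_lhs => rw [← (ℬ x).sum_repr' ψ, ← (ℬ x).sum_repr' φ]
  simp only [bra_sum, bra_smul, LinearMap.sum_apply, LinearMap.smul_apply, sum_inner]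
  refine Finset.sum_congr rfl fun k _ => ?_
  rw [inner_sum, Finset.sum_eq_single k]
  · rw [inner_smul_left, inner_smul_right, Complex.conj_conj, inner_conj_symm]
    ring
  · intro l _ hl
    rw [inner_smul_left, inner_smul_right, h x k l hl.symm, mul_zero, mul_zero]
  · simp

/-- The overlap of the slices along `p` and `q`, expanded in the basis of `p` and in that of `q`,
gives the two sides times the same inner product, which adjacency makes nonzero. -/
lemma inner_bra_eq_of_adj {p q : Fin m × Fin d} (hpq : (transitionGraph ℬ).Adj p q) (e e' : E) :
    inner ℂ (bra (ℬ p.1 p.2) (R e)) (bra (ℬ p.1 p.2) (R e')) =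
      (inner ℂ (bra (ℬ q.1 q.2) (R e)) (bra (ℬ q.1 q.2) (R e')) : ℂ) := by
  have h1 := inner_bra_eq_sum p.1 h (ℬ p.1 p.2) (ℬ q.1 q.2) e e'
  have h2 := inner_bra_eq_sum q.1 h (ℬ p.1 p.2) (ℬ q.1 q.2) e e'
  rw [Finset.sum_eq_single p.2
    (fun k _ hk => by rw [(ℬ p.1).inner_eq_zero hk, mul_zero, zero_mul]) (by simp),
    (ℬ p.1).inner_eq_one, mul_one] at h1
  rw [Finset.sum_eq_single q.2
    (fun k _ hk => by rw [(ℬ q.1).inner_eq_zero hk.symm, zero_mul, zero_mul]) (by simp),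
    (ℬ q.1).inner_eq_one, one_mul] at h2
  exact mul_left_cancel₀ (fun h0 => hpq.2 (inner_eq_zero_symm.1 h0)) (h1.symm.trans h2)

lemma inner_bra_eq_of_mem_supp {p q : Fin m × Fin d} (hp : p ∈ a.supp) (hq : q ∈ a.supp)
    (e e' : E) : inner ℂ (bra (ℬ p.1 p.2) (R e)) (bra (ℬ p.1 p.2) (R e')) =
      (inner ℂ (bra (ℬ q.1 q.2) (R e)) (bra (ℬ q.1 q.2) (R e')) : ℂ) := by
  rw [SimpleGraph.ConnectedComponent.mem_supp_iff] at hp hq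
  obtain ⟨w⟩ := SimpleGraph.ConnectedComponent.exact (hp.trans hq.symm)
  clear hp hq
  induction w with
  | nil => rfl
  | cons hadj _ ih => exact (inner_bra_eq_of_adj h hadj e e').trans ih

lemma exists_inner_bra_componentFactor : ∃ G : E →ₗ[ℂ] E, ∀ ψ φ e e',
    inner ℂ (bra ψ (componentFactor ℬ x a R e)) (bra φ (componentFactor ℬ x a R e')) =
      inner ℂ φ ψ * inner ℂ e (G e') := by
  obtain ⟨p, hp⟩ := a.nonempty_supp
  -- Any vertex `p` of the component serves, as all its vertices share one Gram operator.
  refine ⟨LinearMap.adjoint (bra (ℬ p.1 p.2) ∘ₗ R) ∘ₗ (bra (ℬ p.1 p.2) ∘ₗ R),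
    fun ψ φ e e' => ?_⟩
  rw [bra_componentFactor, bra_componentFactor, inner_bra_eq_sum x h, Submodule.coe_inner,
    ← (ℬ x).sum_inner_mul_inner, Finset.sum_mul]
  refine Finset.sum_congr rfl fun k _ => ?_
  by_cases hk : (x, k) ∈ a.supp
  · rw [inner_bra_eq_of_mem_supp a h hk hp, LinearMap.comp_apply, LinearMap.adjoint_inner_right]
    rfl
  · rw [inner_eq_zero_of_mem_componentSubspace ℬ x hk ψ.2]
    simp

end ZUS

end Components

end ZeroUncertainty

end

/-- The component data of a basis set do not depend on the index `x` of the basis through which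
they are written; the theorem holds for every such choice. -/
theorem theorem2 {HA : Type*} {HB : Type*}
    [NormedAddCommGroup HA] [InnerProductSpace ℂ HA] [FiniteDimensional ℂ HA]
    [NormedAddCommGroup HB] [InnerProductSpace ℂ HB] [FiniteDimensional ℂ HB]
    {m d : ℕ} (ℬ : Fin m → OrthonormalBasis (Fin d) ℂ HA) (x : Fin m)
    (ρ : HA ⊗[ℂ] HB →ₗ[ℂ] HA ⊗[ℂ] HB) (hρ : IsState ρ) :
    IsZUS ℬ ρ ↔
      (∀ a : Component ℬ,
        0 < (LinearMap.trace ℂ (HA ⊗[ℂ] HB) (componentState ℬ x ρ a)).re →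
          componentRank ℬ x a ≤ (Module.finrank ℂ HB : ℝ)) ∧
      (∀ a : Component ℬ,
        0 < (LinearMap.trace ℂ (HA ⊗[ℂ] HB) (componentState ℬ x ρ a)).re →
          IsSubnormalizedMES (restrictA (componentSubspace ℬ x a) (componentState ℬ x ρ a))) ∧
      Pairwise (fun a b : Component ℬ =>
        support (partialTraceA (componentState ℬ x ρ a)) ⟂
          support (partialTraceA (componentState ℬ x ρ b))) := by
  obtain ⟨R, rfl⟩ := exists_comp_adjoint hρ.1
  have htr := hρ.2
  rw [isZUS_iff_inner_bra ℬ htr]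
  refine ⟨fun h => ⟨fun a ha => ?_, fun a ha => ?_, fun a b hab => ?_⟩,
    fun ⟨h1, h2, h3⟩ y k l hkl e e' => ?_⟩
  · obtain ⟨G, hG⟩ := exists_inner_bra_componentFactor x a h
    rw [componentRank_eq, Nat.cast_le]
    refine finrank_le_of_inner_bra hG fun h0 => ?_
    rw [← trace_componentFactor, h0] at ha
    simp at ha
  · obtain ⟨G, hG⟩ := exists_inner_bra_componentFactor x a h
    rw [restrictA_componentState]
    refine isSubnormalizedMES_comp_adjoint hG ?_ ?_
    · rwa [trace_componentFactor]
    · rw [trace_componentFactor]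
      refine (re_trace_componentState_le ℬ x a R).trans ?_
      rw [htr, Complex.one_re]
  · simp_rw [support_partialTraceA_componentState, Submodule.isOrtho_iSup_left,
      Submodule.isOrtho_iSup_right, Submodule.isOrtho_iff_inner_eq]
    rintro k l _ ⟨e, rfl⟩ _ ⟨e', rfl⟩
    rw [LinearMap.comp_apply, LinearMap.comp_apply]
    by_cases hk : (x, k) ∈ a.supp
    · by_cases hl : (x, l) ∈ b.supp
      · rw [componentProj_of_mem ℬ x (apply_mem_componentSubspace ℬ x hk),
          componentProj_of_mem ℬ x (apply_mem_componentSubspace ℬ x hl)]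
        refine h x k l ?_ e e'
        rintro rfl
        exact hab (hk.symm.trans hl)
      · rw [componentProj_of_not_mem ℬ x hl]
        simp
    · rw [componentProj_of_not_mem ℬ x hk]
      simp
  · set a : Component ℬ := (transitionGraph ℬ).connectedComponentMk (y, k)
    set b : Component ℬ := (transitionGraph ℬ).connectedComponentMk (y, l)
    have hk : (y, k) ∈ a.supp := rfl
    have hl : (y, l) ∈ b.supp := rfl
    by_cases hab : a = b
    · rw [← hab] at hl
      set ψ : componentSubspace ℬ x a := ⟨ℬ y k, apply_mem_componentSubspace ℬ x hk⟩
      set φ : componentSubspace ℬ x a := ⟨ℬ y l, apply_mem_componentSubspace ℬ x hl⟩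
      have hψφ : inner ℂ ψ φ = (0 : ℂ) := (ℬ y).inner_eq_zero hkl
      set S := componentFactor ℬ x a R
      have hgoal : inner ℂ (bra ψ (S e)) (bra φ (S e')) = (0 : ℂ) := by
        -- Components of zero weight escape the first two conditions, but there `S = 0`.
        by_cases ha : 0 < (LinearMap.trace ℂ _ (S ∘ₗ LinearMap.adjoint S)).re
        · have ha' := ha
          rw [trace_componentFactor] at ha'
          have hdim := h1 a ha'
          rw [componentRank_eq, Nat.cast_le] at hdim
          have hmes := h2 a ha'
          rw [restrictA_componentState] at hmes
          have hT : LinearMap.adjoint (bra φ ∘ₗ S) ∘ₗ (bra ψ ∘ₗ S) = 0 := by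
            -- Maximal entanglement gives orthogonality only for a common vector `f`; complex
            -- polarization extends it to different `e` and `e'`.
            rw [← inner_map_self_eq_zero]
            intro f
            rw [LinearMap.comp_apply, LinearMap.adjoint_inner_left]
            exact inner_bra_eq_zero_of_isSubnormalizedMES hmes hdim f hψφ
          have := LinearMap.congr_fun hT e
          rw [LinearMap.comp_apply] at this
          rw [← LinearMap.comp_apply (bra φ) S, ← LinearMap.adjoint_inner_left]
          refine (congrArg (fun z => inner ℂ z e') this).trans ?_
          simp
        · have := eq_zero_of_trace_comp_adjoint
            (le_antisymm (not_lt.1 ha) (re_trace_comp_adjoint_nonneg S))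
          rw [this]
          simp
      rwa [bra_componentFactor, bra_componentFactor] at hgoal
    · exact Submodule.isOrtho_iff_inner_eq.1 (h3 hab) _
        (bra_mem_support ℬ x R (apply_mem_componentSubspace ℬ x hk) e) _
        (bra_mem_support ℬ x R (apply_mem_componentSubspace ℬ x hl) e')
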